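/- **Theorem (Complexity-Theoretic No-Cloning).** For an $n$-qubit pure state $|\psi\rangle$ let $U_\psi$ be the oracle with $U_\psi|\psi\rangle=-|\psi\rangle$ and $U_\psi|\phi\rangle=|\phi\rangle$ for all $|\phi\rangle$ orthogonal to $|\psi\rangle$. There is a universal constant $c>0$ such that the following holds for all $n$, all $k\ge 1$, all $\ell>k$, all $\delta>0$ and all $T$. Suppose that a quantum algorithm (unitary gates that do not depend on $\psi$, with an arbitrary finite number of ancilla qubits), given the initial state $|\psi\rangle^{\otimes k}$ and making $T$ (possibly controlled) queries to $U_\psi$, prepares for every $n$-qubit pure state $|\psi\rangle$ an output on $\ell$ registers of $n$ qubits whose reduced states $\rho_1,\dots,\rho_\ell$ satisfy $$\sum_{i=1}^{\ell}\langle\psi|\rho_i|\psi\rangle\ \ge\ k+\delta .$$ Then $$T\ \ge\ c\left(\frac{\delta^2\sqrt{2^n}}{\ell^2\,k\,\log(\max\{k,2\})}-\ell\right),$$ where $\log$ is the natural logarithm. In other words, $\Omega\!\left(\frac{\delta^2\sqrt{2^n}}{\ell^2k\log k}-\ell\right)$ queries to $U_\psi$ are needed, where for $k=1$ the factor $\log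 k$ is read as $\log 2$. -/

import Mathlib

/-- The computational basis of an `n`-qubit register. -/
abbrev Reg (n : ℕ) : Type := Fin n → Bool

/-- The computational basis of the whole workspace of an algorithm: `ℓ` registers of `n` qubits
(they hold the input copies at the start and are the output registers at the end), a control qubit
and an `n`-qubit register to which the oracle is applied, and `m` ancilla qubits. -/
structure Work (n ℓ m : ℕ) : Type where
  out : Fin ℓ → Reg n
  ctrl : Bool
  query : Reg n
  anc : Fin m → Bool
deriving DecidableEq, Fintype

/-- A state vector of the workspace, given by its amplitudes in the computational basis. -/
abbrev WorkVec (n ℓ m : ℕ) : Type := Work n ℓ m → ℂ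

noncomputable section

/-- The reflection `U_ψ = 1 - 2 |ψ⟩⟨ψ|`. -/
def oracle {n : ℕ} (ψ : EuclideanSpace ℂ (Reg n)) : Matrix (Reg n) (Reg n) ℂ :=
  1 - (2 : ℂ) • Matrix.vecMulVec ψ.ofLp (star ψ.ofLp)

/-- For a unit vector `ψ`, the oracle maps `ψ` to `-ψ`. -/
theorem oracle_mulVec_self {n : ℕ} (ψ : EuclideanSpace ℂ (Reg n)) (hψ : ‖ψ‖ = 1) :
    (oracle ψ).mulVec ψ.ofLp = -ψ.ofLp := by
  have h : star ψ.ofLp ⬝ᵥ ψ.ofLp = 1 := by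
    have h1 : inner ℂ ψ ψ = (1 : ℂ) := by
      rw [inner_self_eq_norm_sq_to_K, hψ]; simp
    rw [EuclideanSpace.inner_eq_star_dotProduct] at h1
    rwa [dotProduct_comm]
  rw [oracle, Matrix.sub_mulVec, Matrix.smul_mulVec, Matrix.vecMulVec_mulVec, h]
  ext x
  simp
  ring

/-- The oracle fixes every vector orthogonal to `ψ`. -/
theorem oracle_mulVec_of_orthogonal {n : ℕ} (ψ φ : EuclideanSpace ℂ (Reg n))
    (h : inner ℂ ψ φ = (0 : ℂ)) : (oracle ψ).mulVec φ.ofLp = φ.ofLp := by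
  have h : star ψ.ofLp ⬝ᵥ φ.ofLp = 0 := by
    rw [EuclideanSpace.inner_eq_star_dotProduct] at h
    rwa [dotProduct_comm]
  rw [oracle, Matrix.sub_mulVec, Matrix.smul_mulVec, Matrix.vecMulVec_mulVec, h]
  ext x
  simp

/-- One query: `U_ψ` is applied to the query register if the control qubit is `1`, and nothing
happens if it is `0` (so an uncontrolled query is the case where the control qubit is set to `1`;
`U_ψ` is its own inverse). -/
def applyQuery {n ℓ m : ℕ} (ψ : EuclideanSpace ℂ (Reg n)) (Φ : WorkVec n ℓ m) :
    WorkVec n ℓ m :=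
  fun s => if s.ctrl then ∑ x, oracle ψ s.query x * Φ { s with query := x } else Φ s

/-- The initial state: `|ψ⟩` in each of the first `k` registers, every other qubit is `|0⟩`. -/
def initialState {n : ℕ} (ℓ m k : ℕ) (ψ : EuclideanSpace ℂ (Reg n)) : WorkVec n ℓ m :=
  fun s =>
    (∏ i : Fin ℓ, if (i : ℕ) < k then ψ (s.out i) else if s.out i = fun _ => false then 1 else 0) *
      (if s.ctrl = false ∧ (s.query = fun _ => false) ∧ (s.anc = fun _ => false) then 1 else 0)

/-- The state of the algorithm with gates `V 0, V 1, …` after `t` queries: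
`V t · Q_ψ · V (t - 1) ⋯ Q_ψ · V 0` applied to the initial state, where `Q_ψ` is one query.
The gates are arbitrary unitaries on the whole workspace, which do not depend on `ψ`. -/
def runState {n ℓ m : ℕ} (V : ℕ → Matrix.unitaryGroup (Work n ℓ m) ℂ) (k : ℕ)
    (ψ : EuclideanSpace ℂ (Reg n)) : ℕ → WorkVec n ℓ m
  | 0 => (V 0 : Matrix (Work n ℓ m) (Work n ℓ m) ℂ).mulVec (initialState ℓ m k ψ)
  | t + 1 => (V (t + 1) : Matrix (Work n ℓ m) (Work n ℓ m) ℂ).mulVec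
      (applyQuery ψ (runState V k ψ t))

/-- The reduced density matrix of `|Φ⟩⟨Φ|` on the `i`-th register (partial trace over all the
rest of the workspace). -/
def reducedState {n ℓ m : ℕ} (Φ : WorkVec n ℓ m) (i : Fin ℓ) : Matrix (Reg n) (Reg n) ℂ :=
  fun a b => ∑ s : Work n ℓ m,
    if s.out i = a then Φ s * star (Φ { s with out := Function.update s.out i b }) else 0

/-- The fidelity `⟨ψ|ρ|ψ⟩`. -/
def fidelity {n : ℕ} (ψ : EuclideanSpace ℂ (Reg n)) (ρ : Matrix (Reg n) (Reg n) ℂ) : ℝ :=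
  (star ψ.ofLp ⬝ᵥ ρ.mulVec ψ.ofLp).re

end

set_option linter.unusedSectionVars false

open scoped ComplexConjugate

/-! ### The discrete Poisson kernel -/


/-! It is enough to bound the average over the phase states `N^(-1/2) ∑ ω^(θ x) |x⟩`, where `N = 2 ^
n`, `θ` ranges over `(ℤ/q)^X`, `q = 4k`, and `ω` is a primitive `q`-th root of unity. Expand the
state of the algorithm in characters of `θ`. An index `α` acts as a vector of occupation numbers,
and the expected number of correct registers is a sum of squared norms of lowering operators applied
to the coefficients (`sum_fidelity_eq`). Two facts then carry the proof.

Counting: if all coefficients lie in the sector where the standard representatives of `α` sum to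
`k`, lowering can succeed on at most about `k` registers, with an error of `(k+1)ℓ/N` from
wrap-around modulo `q` (`sum_ampSq_lower_le`, by induction on `k` with raising operators as
adjoints).

Stability: take noise `ξ` with `E χ_α(ξ) = ρ^|α|`, where `|α|` sums the distances to `0`. The
average of `⟨Φ_θ, Φ_(θ+ξ)⟩` is `∑ ρ^|α| ‖coefficient at α‖²`. It is at least `ρ^k` for the input,
gates preserve it, and a query changes it by at most `8/√N` (`IsPoissonNoise.query_step`). A global
phase of `ψ` is seen only by the `k` input copies, so `∑ α = k` modulo `4k`; hence `α` is in the
sector or `|α| > k` (`valSum_eq_or_lt_absSum`). Weight outside the sector thus lowers the stability,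
and few queries leave little weight there (`offSector_weight_le`).

`excess_bounds` joins the two facts, and `query_bound_of_excess` chooses the free parameter. The
logarithm enters only through a constant lower bound. -/

theorem poissonSum_eq (h : ℕ) (z : ℂ) (hz : z ^ (2 * h) = 1) (hh : 0 < h) (ρ : ℝ) (h0 : 0 ≤ ρ)
    (h1 : ρ < 1) :
    ∃ r : ℝ, 0 ≤ r ∧ (∑ v ∈ Finset.range h, (ρ : ℂ) ^ v * z ^ v) +
      ∑ v ∈ Finset.range h, (ρ : ℂ) ^ (h - v) * z ^ (h + v) = r := by
  have hn : ‖z‖ = 1 := Complex.norm_eq_one_of_pow_eq_one hz (by omega)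
  have hz0 : z ≠ 0 := by
    rintro rfl
    simp at hn
  have hconj : z⁻¹ = conj z := Complex.inv_eq_conj hn
  have hsq : (z ^ h - 1) * (z ^ h + 1) = 0 := by
    have : z ^ (2 * h) = z ^ h * z ^ h := by rw [two_mul, pow_add]
    linear_combination hz - this
  obtain ⟨ε, hε, hεb⟩ : ∃ ε : ℝ, z ^ h = (ε : ℂ) ∧ (ε = 1 ∨ ε = -1) := by
    rcases mul_eq_zero.1 hsq with h2 | h2
    · exact ⟨1, by simpa using sub_eq_zero.1 h2, Or.inl rfl⟩
    · exact ⟨-1, by simpa using eq_neg_of_add_eq_zero_left h2, Or.inr rfl⟩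
  have hne : ∀ y : ℂ, ‖y‖ = 1 → 1 - (ρ : ℂ) * y ≠ 0 := by
    intro y hy h2
    have h3 : (ρ : ℂ) * y = 1 := (sub_eq_zero.1 h2).symm
    have h4 : ‖(ρ : ℂ) * y‖ = 1 := by rw [h3]; simp
    rw [norm_mul, hy, Complex.norm_real, Real.norm_of_nonneg h0] at h4
    linarith
  have hne1 := hne z hn
  have hne2 := hne z⁻¹ (by simp [hn])
  have hA : (1 - (ρ : ℂ) * z) * (∑ v ∈ Finset.range h, (ρ : ℂ) ^ v * z ^ v) = 1 - ρ ^ h * ε := by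
    simp_rw [← mul_pow]
    rw [mul_neg_geom_sum, mul_pow, hε]
  have hεinv : (z⁻¹) ^ h = (ε : ℂ) := by
    rw [inv_pow, hε]
    rcases hεb with rfl | rfl <;> norm_num
  have hB0 : (∑ v ∈ Finset.range h, (ρ : ℂ) ^ (h - v) * z ^ (h + v)) =
      ρ * z⁻¹ * ∑ v ∈ Finset.range h, ((ρ : ℂ) * z⁻¹) ^ v := by
    rw [← Finset.sum_range_reflect, Finset.mul_sum]
    refine Finset.sum_congr rfl fun u hu => ?_
    have hu' := Finset.mem_range.1 hu
    have e1 : h - (h - 1 - u) = u + 1 := by omega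
    have e2 : z ^ (h + (h - 1 - u)) = (z⁻¹) ^ (u + 1) := by
      rw [inv_pow]
      refine eq_inv_of_mul_eq_one_left ?_
      rw [← pow_add, ← hz]
      congr 1
      omega
    rw [e1, e2, mul_pow]
    ring
  have hB : (1 - (ρ : ℂ) * z⁻¹) * (∑ v ∈ Finset.range h, (ρ : ℂ) ^ (h - v) * z ^ (h + v)) =
      ρ * z⁻¹ * (1 - ρ ^ h * ε) := by
    rw [hB0, mul_left_comm, mul_neg_geom_sum, mul_pow, hεinv]
  -- Both half sums are geometric and share the factor `1 - ρ ^ h * ε`, because `z ^ h = ε = ±1`.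
  -- Over a common denominator they add up to this factor times the Poisson kernel.
  refine ⟨(1 - ρ ^ h * ε) * (1 - ρ ^ 2) / Complex.normSq (1 - ρ * z), ?_, ?_⟩
  · refine div_nonneg (mul_nonneg ?_ ?_) (Complex.normSq_nonneg _)
    · have : ρ ^ h ≤ 1 := pow_le_one₀ h0 h1.le
      have h5 : 0 ≤ ρ ^ h := pow_nonneg h0 h
      rcases hεb with rfl | rfl <;> linarith
    · nlinarith
  · have hns : ((Complex.normSq (1 - ρ * z) : ℝ) : ℂ) = (1 - ρ * z) * (1 - ρ * z⁻¹) := by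
      rw [Complex.normSq_eq_conj_mul_self, hconj, mul_comm]
      simp
    push_cast
    rw [hns, eq_div_iff (mul_ne_zero hne1 hne2), add_mul]
    have hzz : z * z⁻¹ = 1 := mul_inv_cancel₀ hz0
    calc _ = ((1 - (ρ : ℂ) * z) * (∑ v ∈ Finset.range h, (ρ : ℂ) ^ v * z ^ v)) * (1 - ρ * z⁻¹) +
        ((1 - (ρ : ℂ) * z⁻¹) * (∑ v ∈ Finset.range h, (ρ : ℂ) ^ (h - v) * z ^ (h + v))) *
          (1 - ρ * z) := by ring
      _ = _ := by
        rw [hA, hB]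
        linear_combination (-(ρ : ℂ) ^ 2 * (1 - ρ ^ h * ε)) * hzz

/-- An even modulus splits cleanly: for `v < h` the residues `v` and `h + v` lie at distances `v`
and `h - v` from `0`, which gives the two half sums of `poissonSum_eq`. -/
theorem sum_poisson_char (h : ℕ) [NeZero (2 * h)] (ρ : ℝ) (h0 : 0 ≤ ρ) (h1 : ρ < 1)
    (j : ZMod (2 * h)) :
    ∃ r : ℝ, 0 ≤ r ∧
      ∑ m : ZMod (2 * h), (ρ : ℂ) ^ m.valMinAbs.natAbs * ZMod.stdAddChar (m * j) = r := by
  have hh : 0 < h := by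
    have := NeZero.ne (2 * h)
    omega
  have hchar : ∀ v : ℕ, ZMod.stdAddChar ((v : ZMod (2 * h)) * j) = ZMod.stdAddChar j ^ v := by
    intro v
    rw [← nsmul_eq_mul, AddChar.map_nsmul_eq_pow]
  obtain ⟨r, hr, hs⟩ := poissonSum_eq h (ZMod.stdAddChar j) (by
    rw [← hchar]
    simp only [CharP.cast_eq_zero, zero_mul, AddChar.map_zero_eq_one]) hh ρ h0 h1
  refine ⟨r, hr, ?_⟩
  rw [← hs]
  have e : ∀ f : ZMod (2 * h) → ℂ, ∑ m, f m = ∑ v ∈ Finset.range (2 * h), f v := by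
    intro f
    symm
    refine Finset.sum_bij (fun v _ => (v : ZMod (2 * h))) (by simp) ?_ ?_ (by simp)
    · intro a ha b hb hab
      have := congrArg ZMod.val hab
      rwa [ZMod.val_natCast_of_lt (Finset.mem_range.1 ha),
        ZMod.val_natCast_of_lt (Finset.mem_range.1 hb)] at this
    · intro b _
      exact ⟨b.val, Finset.mem_range.2 (ZMod.val_lt b), ZMod.natCast_zmod_val b⟩
  rw [e, show Finset.range (2 * h) = Finset.range (h + h) by rw [two_mul], Finset.sum_range_add]
  refine congrArg₂ (· + ·) ?_ ?_
  · refine Finset.sum_congr rfl fun v hv => ?_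
    have hv' := Finset.mem_range.1 hv
    rw [← hchar, ZMod.valMinAbs_natCast_of_le_half (by omega)]
    simp
  · refine Finset.sum_congr rfl fun v hv => ?_
    have hv' := Finset.mem_range.1 hv
    rw [← hchar]
    congr 2
    rw [ZMod.valMinAbs_natAbs_eq_min, ZMod.val_natCast_of_lt (by omega)]
    omega

/-- Fourier inversion: the transform of `ρ ^ |m|` is nonnegative, so after a reflection and division
by `2h` it serves as the weight. -/
theorem exists_poissonKernel (h : ℕ) [NeZero (2 * h)] (ρ : ℝ) (h0 : 0 ≤ ρ) (h1 : ρ < 1) :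
    ∃ κ : ZMod (2 * h) → ℝ, (∀ j, 0 ≤ κ j) ∧
      ∀ m, ∑ j, (κ j : ℂ) * ZMod.stdAddChar (m * j) = (ρ : ℂ) ^ m.valMinAbs.natAbs := by
  choose r hr hs using sum_poisson_char h ρ h0 h1
  have hq : ((2 * h : ℕ) : ℂ) ≠ 0 := Nat.cast_ne_zero.2 (NeZero.ne _)
  refine ⟨fun j => r (-j) / (2 * h : ℕ), fun j => div_nonneg (hr _) (Nat.cast_nonneg _), ?_⟩
  intro m
  have : ∀ j : ZMod (2 * h), ((r (-j) / (2 * h : ℕ) : ℝ) : ℂ) * ZMod.stdAddChar (m * j) =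
      ∑ m' : ZMod (2 * h), ((2 * h : ℕ) : ℂ)⁻¹ * ((ρ : ℂ) ^ m'.valMinAbs.natAbs *
        ZMod.stdAddChar (j * (m - m'))) := by
    intro j
    rw [Complex.ofReal_div, ← hs, ← Finset.mul_sum, div_eq_inv_mul, mul_assoc, Finset.sum_mul]
    congr 1
    refine Finset.sum_congr rfl fun m' _ => ?_
    rw [mul_assoc, ← AddChar.map_add_eq_mul]
    congr 2
    ring
  simp_rw [this]
  rw [Finset.sum_comm]
  simp_rw [← Finset.mul_sum, AddChar.sum_mulShift _ (ZMod.isPrimitive_stdAddChar (2 * h)),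
    sub_eq_zero, ZMod.card]
  rw [Finset.sum_eq_single m]
  · rw [if_pos rfl]
    field_simp
  · intro b _ hb
    rw [if_neg (Ne.symm hb)]
    simp
  · simp

/-! ### Characters of a power of a cyclic group -/

section phases

variable {X : Type*} [Fintype X] {q : ℕ} [NeZero q]

/-- The character of `(ℤ/q)^X` with index `α`. -/
noncomputable def phaseChar (α θ : X → ZMod q) : ℂ := ZMod.stdAddChar (∑ x, α x * θ x)

/-- The length of a character index: the sum of the distances to `0` of its entries. -/
def absSum (α : X → ZMod q) : ℕ := ∑ x, (α x).valMinAbs.natAbs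

theorem phaseChar_eq_prod (α θ : X → ZMod q) :
    phaseChar α θ = ∏ x, ZMod.stdAddChar (α x * θ x) := by
  rw [phaseChar]
  exact map_prod (AddChar.toMonoidHom (ZMod.stdAddChar (N := q)))
    (fun x => Multiplicative.ofAdd (α x * θ x)) Finset.univ

theorem phaseChar_add_right (α θ ξ : X → ZMod q) :
    phaseChar α (θ + ξ) = phaseChar α θ * phaseChar α ξ := by
  rw [phaseChar, phaseChar, phaseChar, ← AddChar.map_add_eq_mul, ← Finset.sum_add_distrib]
  simp [mul_add]

theorem phaseChar_comm (α θ : X → ZMod q) : phaseChar α θ = phaseChar θ α := by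
  simp [phaseChar, mul_comm]

theorem phaseChar_add_left (α β θ : X → ZMod q) :
    phaseChar (α + β) θ = phaseChar α θ * phaseChar β θ := by
  rw [phaseChar_comm, phaseChar_add_right, phaseChar_comm θ, phaseChar_comm θ]

@[simp] theorem phaseChar_zero_left (θ : X → ZMod q) : phaseChar 0 θ = 1 := by
  simp [phaseChar]

theorem stdAddChar_conj (j : ZMod q) : conj (ZMod.stdAddChar j) = ZMod.stdAddChar (-j) := by
  rw [AddChar.map_neg_eq_conj]

theorem phaseChar_neg_left (α θ : X → ZMod q) : phaseChar (-α) θ = conj (phaseChar α θ) := by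
  rw [phaseChar, phaseChar, stdAddChar_conj]
  simp

theorem phaseChar_neg_right (α θ : X → ZMod q) : phaseChar α (-θ) = conj (phaseChar α θ) := by
  rw [phaseChar_comm, phaseChar_neg_left, phaseChar_comm]

variable [DecidableEq X]

theorem phaseChar_single (x : X) (θ : X → ZMod q) :
    phaseChar (Pi.single x 1) θ = ZMod.stdAddChar (θ x) := by
  simp [phaseChar, Pi.single_apply]

theorem sum_phaseChar (α : X → ZMod q) :
    ∑ θ : X → ZMod q, phaseChar α θ = if α = 0 then (Fintype.card (X → ZMod q) : ℂ) else 0 := by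
  split_ifs with h
  · subst h
    simp
  · obtain ⟨x, hx⟩ := Function.ne_iff.1 h
    simp_rw [phaseChar_eq_prod]
    rw [← Fintype.prod_sum (fun x j => ZMod.stdAddChar (α x * j))]
    refine Finset.prod_eq_zero (Finset.mem_univ x) ?_
    simp_rw [mul_comm (α x)]
    rw [AddChar.sum_mulShift _ (ZMod.isPrimitive_stdAddChar q), if_neg (by simpa using hx),
      Nat.cast_zero]

/-- The Fourier coefficients of a function on `(ℤ/q)^X`. -/
noncomputable def phaseCoeff (F : (X → ZMod q) → ℂ) (α : X → ZMod q) : ℂ :=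
  (Fintype.card (X → ZMod q) : ℂ)⁻¹ * ∑ θ, conj (phaseChar α θ) * F θ

theorem sum_phaseChar_mul_phaseCoeff (F : (X → ZMod q) → ℂ) (θ : X → ZMod q) :
    ∑ α, phaseChar α θ * phaseCoeff F α = F θ := by
  have hq : (Fintype.card (X → ZMod q) : ℂ) ≠ 0 := Nat.cast_ne_zero.2 Fintype.card_ne_zero
  have : ∀ α : X → ZMod q, phaseChar α θ * phaseCoeff F α =
      ∑ θ', (Fintype.card (X → ZMod q) : ℂ)⁻¹ * F θ' * phaseChar (θ - θ') α := by
    intro α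
    rw [phaseCoeff, mul_left_comm, Finset.mul_sum, Finset.mul_sum]
    refine Finset.sum_congr rfl fun θ' _ => ?_
    rw [sub_eq_add_neg, phaseChar_add_left, phaseChar_comm (-θ'), phaseChar_neg_right,
      phaseChar_comm θ]
    ring
  simp_rw [this]
  rw [Finset.sum_comm]
  simp_rw [← Finset.mul_sum, sum_phaseChar, sub_eq_zero]
  rw [Finset.sum_eq_single θ]
  · rw [if_pos rfl]
    field_simp
  · intro b _ hb
    rw [if_neg (Ne.symm hb), mul_zero]
  · simp

theorem sum_conj_mul_synthesis (a b : (X → ZMod q) → ℂ) :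
    ∑ θ, conj (∑ α, phaseChar α θ * a α) * (∑ α, phaseChar α θ * b α) =
      Fintype.card (X → ZMod q) * ∑ α, conj (a α) * b α := by
  have : ∀ θ : X → ZMod q,
      conj (∑ α, phaseChar α θ * a α) * (∑ α, phaseChar α θ * b α) =
      ∑ α, ∑ β, conj (a α) * b β * phaseChar (β - α) θ := by
    intro θ
    rw [map_sum, Finset.sum_mul_sum]
    refine Finset.sum_congr rfl fun α _ => Finset.sum_congr rfl fun β _ => ?_
    rw [sub_eq_add_neg, phaseChar_add_left, phaseChar_neg_left, map_mul]
    ring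
  simp_rw [this]
  rw [Finset.sum_comm, Finset.mul_sum]
  refine Finset.sum_congr rfl fun α _ => ?_
  rw [Finset.sum_comm]
  simp_rw [← Finset.mul_sum, sum_phaseChar, sub_eq_zero]
  rw [Finset.sum_eq_single α]
  · rw [if_pos rfl]
    ring
  · intro b _ hb
    rw [if_neg hb, mul_zero]
  · simp

theorem sum_normSq_synthesis (a : (X → ZMod q) → ℂ) :
    ∑ θ, ‖∑ α, phaseChar α θ * a α‖ ^ 2 = Fintype.card (X → ZMod q) * ∑ α, ‖a α‖ ^ 2 := by
  have := sum_conj_mul_synthesis a a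
  simp_rw [Complex.conj_mul'] at this
  exact_mod_cast this

theorem sum_normSq_phaseCoeff (F : (X → ZMod q) → ℂ) :
    Fintype.card (X → ZMod q) * ∑ α, ‖phaseCoeff F α‖ ^ 2 = ∑ θ, ‖F θ‖ ^ 2 := by
  rw [← sum_normSq_synthesis]
  simp_rw [sum_phaseChar_mul_phaseCoeff]

/-- `w` is a probability distribution on `(ℤ/q)^X` whose Fourier transform is `ρ ^ absSum`. -/
structure IsPoissonNoise (ρ : ℝ) (w : (X → ZMod q) → ℝ) : Prop where
  nonneg : ∀ ξ, 0 ≤ w ξ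
  sum_char : ∀ α, ∑ ξ, (w ξ : ℂ) * phaseChar α ξ = (ρ : ℂ) ^ absSum α

theorem exists_isPoissonNoise {h : ℕ} (hq : q = 2 * h) (ρ : ℝ) (h0 : 0 ≤ ρ) (h1 : ρ < 1) :
    ∃ w : (X → ZMod q) → ℝ, IsPoissonNoise ρ w := by
  subst hq
  obtain ⟨κ, hκ, hs⟩ := exists_poissonKernel h ρ h0 h1
  refine ⟨fun ξ => ∏ x, κ (ξ x), fun ξ => Finset.prod_nonneg fun x _ => hκ _, fun α => ?_⟩
  simp_rw [phaseChar_eq_prod, Complex.ofReal_prod, ← Finset.prod_mul_distrib]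
  rw [← Fintype.prod_sum (fun x j => (κ j : ℂ) * ZMod.stdAddChar (α x * j))]
  simp_rw [hs]
  rw [Finset.prod_pow_eq_pow_sum, absSum]

theorem IsPoissonNoise.sum_eq_one {ρ : ℝ} {w : (X → ZMod q) → ℝ} (hw : IsPoissonNoise ρ w) :
    ∑ ξ, w ξ = 1 := by
  have := hw.sum_char 0
  simp only [phaseChar_zero_left, mul_one, absSum, Pi.zero_apply, ZMod.valMinAbs_zero,
    Int.natAbs_zero, Finset.sum_const_zero, pow_zero] at this
  exact_mod_cast this

/-- Translation by `ξ` multiplies the coefficient at `α` by `phaseChar α ξ`, and the noise average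
of that factor is `ρ ^ absSum α`. -/
theorem IsPoissonNoise.stability {ρ : ℝ} {w : (X → ZMod q) → ℝ} (hw : IsPoissonNoise ρ w)
    (F : (X → ZMod q) → ℂ) :
    ∑ θ, ∑ ξ, (w ξ : ℂ) * (conj (F θ) * F (θ + ξ)) =
      ((Fintype.card (X → ZMod q) * ∑ α, ρ ^ absSum α * ‖phaseCoeff F α‖ ^ 2 : ℝ) : ℂ) := by
  rw [Finset.sum_comm]
  have h1 : ∀ ξ, ∑ θ, (w ξ : ℂ) * (conj (F θ) * F (θ + ξ)) =
      ∑ α, Fintype.card (X → ZMod q) * (conj (phaseCoeff F α) * phaseCoeff F α) *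
        (w ξ * phaseChar α ξ) := by
    intro ξ
    have e := sum_conj_mul_synthesis (phaseCoeff F) (fun α => phaseChar α ξ * phaseCoeff F α)
    have e2 : ∀ θ : X → ZMod q, ∑ α, phaseChar α θ * (phaseChar α ξ * phaseCoeff F α) =
        F (θ + ξ) := by
      intro θ
      rw [← sum_phaseChar_mul_phaseCoeff F (θ + ξ)]
      simp_rw [phaseChar_add_right, mul_assoc]
    simp_rw [e2, sum_phaseChar_mul_phaseCoeff] at e
    rw [← Finset.mul_sum, e, Finset.mul_sum, Finset.mul_sum]
    refine Finset.sum_congr rfl fun α _ => ?_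
    ring
  simp_rw [h1]
  rw [Finset.sum_comm]
  simp_rw [← Finset.mul_sum, hw.sum_char, Complex.conj_mul']
  push_cast
  rw [Finset.mul_sum]
  refine Finset.sum_congr rfl fun α _ => ?_
  ring

end phases

/-! ### The effect of one query on the noise stability -/

section query

variable {X : Type*} [Fintype X] [DecidableEq X] {q : ℕ} [NeZero q]

theorem absSum_neg (α : X → ZMod q) : absSum (-α) = absSum α := by
  simp [absSum]

theorem absSum_add_le (α β : X → ZMod q) : absSum (α + β) ≤ absSum α + absSum β := by
  rw [absSum, absSum, absSum, ← Finset.sum_add_distrib]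
  refine Finset.sum_le_sum fun x _ => ?_
  exact (ZMod.natAbs_valMinAbs_add_le _ _).trans (Int.natAbs_add_le _ _)

theorem natAbs_valMinAbs_one (hq : 2 ≤ q) : (1 : ZMod q).valMinAbs.natAbs = 1 := by
  have : Fact (1 < q) := ⟨hq⟩
  rw [ZMod.valMinAbs_natAbs_eq_min, ZMod.val_one]
  omega

theorem absSum_single (hq : 2 ≤ q) (x : X) : absSum (Pi.single x (1 : ZMod q)) = 1 := by
  rw [absSum, Finset.sum_eq_single x]
  · simp [natAbs_valMinAbs_one hq]
  · intro b _ hb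
    simp [Pi.single_eq_of_ne hb]
  · simp

theorem absSum_single_sub_single (hq : 2 ≤ q) {x y : X} (h : x ≠ y) :
    absSum (Pi.single y 1 - Pi.single x 1 : X → ZMod q) = 2 := by
  have : ∀ z, ((Pi.single y 1 - Pi.single x 1 : X → ZMod q) z).valMinAbs.natAbs =
      (if z = y then 1 else 0) + (if z = x then 1 else 0) := by
    intro z
    rw [Pi.sub_apply, Pi.single_apply, Pi.single_apply]
    by_cases h1 : z = y
    · have h2 : z ≠ x := fun h2 => h (h2.symm.trans h1)
      simp [h1, natAbs_valMinAbs_one hq, Ne.symm h]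
    · by_cases h2 : z = x
      · simp [h2, h, natAbs_valMinAbs_one hq]
      · simp [h1, h2]
  rw [absSum]
  simp_rw [this]
  rw [Finset.sum_add_distrib]
  simp

variable {ρ : ℝ} {w : (X → ZMod q) → ℝ}

/-- For `x ≠ y` the index `e_y - e_x` has length 2, so the mean of the product is `ρ²`, the product
of the means. Thus the phases at distinct points are uncorrelated. -/
theorem IsPoissonNoise.covariance (hw : IsPoissonNoise ρ w) (hq : 2 ≤ q) (x y : X) :
    ∑ ξ, (w ξ : ℂ) * (conj (ZMod.stdAddChar (ξ x) - (ρ : ℂ)) * (ZMod.stdAddChar (ξ y) - ρ)) =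
      if x = y then 1 - (ρ : ℂ) ^ 2 else 0 := by
  have e : ∀ ξ : X → ZMod q, (w ξ : ℂ) *
      (conj (ZMod.stdAddChar (ξ x) - (ρ : ℂ)) * (ZMod.stdAddChar (ξ y) - ρ)) =
      w ξ * phaseChar (Pi.single y 1 - Pi.single x 1) ξ -
        ρ * (w ξ * phaseChar (-Pi.single x 1) ξ) - ρ * (w ξ * phaseChar (Pi.single y 1) ξ) +
        ρ ^ 2 * (w ξ * phaseChar 0 ξ) := by
    intro ξ
    rw [sub_eq_add_neg (Pi.single y 1), phaseChar_add_left, phaseChar_neg_left, phaseChar_single,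
      phaseChar_single, phaseChar_zero_left, map_sub, Complex.conj_ofReal]
    ring
  simp_rw [e]
  rw [Finset.sum_add_distrib, Finset.sum_sub_distrib, Finset.sum_sub_distrib]
  simp_rw [← Finset.mul_sum, hw.sum_char, absSum_neg, absSum_single hq]
  have h0 : absSum (0 : X → ZMod q) = 0 := by simp [absSum]
  rw [h0]
  split_ifs with h
  · subst h
    rw [sub_self, h0]
    ring
  · rw [absSum_single_sub_single hq h]
    ring

theorem IsPoissonNoise.variance_le (hw : IsPoissonNoise ρ w) (hq : 2 ≤ q) (z : X → ℂ) :
    ∑ ξ, w ξ * ‖∑ x, (ZMod.stdAddChar (ξ x) - (ρ : ℂ)) * z x‖ ^ 2 ≤ ∑ x, ‖z x‖ ^ 2 := by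
  have key : ((∑ ξ, w ξ * ‖∑ x, (ZMod.stdAddChar (ξ x) - (ρ : ℂ)) * z x‖ ^ 2 : ℝ) : ℂ) =
      ((1 - ρ ^ 2) * ∑ x, ‖z x‖ ^ 2 : ℝ) := by
    push_cast
    have e : ∀ ξ : X → ZMod q, (w ξ : ℂ) *
        (‖∑ x, (ZMod.stdAddChar (ξ x) - (ρ : ℂ)) * z x‖ : ℂ) ^ 2 =
        ∑ x, ∑ y, conj (z x) * z y * ((w ξ : ℂ) *
          (conj (ZMod.stdAddChar (ξ x) - (ρ : ℂ)) * (ZMod.stdAddChar (ξ y) - ρ))) := by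
      intro ξ
      rw [← Complex.conj_mul', map_sum, Finset.sum_mul_sum, Finset.mul_sum]
      refine Finset.sum_congr rfl fun x _ => ?_
      rw [Finset.mul_sum]
      refine Finset.sum_congr rfl fun y _ => ?_
      rw [map_mul]
      ring
    simp_rw [e]
    rw [Finset.sum_comm, Finset.mul_sum]
    refine Finset.sum_congr rfl fun x _ => ?_
    rw [Finset.sum_comm]
    simp_rw [← Finset.mul_sum, hw.covariance hq]
    simp only [mul_ite, mul_zero, Finset.sum_ite_eq, Finset.mem_univ, if_true]
    rw [Complex.conj_mul']
    ring
  have key' := Complex.ofReal_injective key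
  rw [key']
  have : 0 ≤ ∑ x, ‖z x‖ ^ 2 := Finset.sum_nonneg fun x _ => sq_nonneg _
  nlinarith [sq_nonneg ρ]

theorem IsPoissonNoise.variance_conj_le (hw : IsPoissonNoise ρ w) (hq : 2 ≤ q) (z : X → ℂ) :
    ∑ ξ, w ξ * ‖∑ x, (conj (ZMod.stdAddChar (ξ x)) - (ρ : ℂ)) * z x‖ ^ 2 ≤ ∑ x, ‖z x‖ ^ 2 := by
  have := hw.variance_le hq (fun x => conj (z x))
  simp_rw [Complex.norm_conj] at this
  refine le_trans (le_of_eq ?_) this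
  refine Finset.sum_congr rfl fun ξ _ => ?_
  rw [← Complex.norm_conj, map_sum]
  simp

/-- The uniform superposition with phases given by `θ`. -/
noncomputable def phaseState (θ : X → ZMod q) (x : X) : ℂ :=
  ((√(Fintype.card X : ℝ))⁻¹ : ℝ) * ZMod.stdAddChar (θ x)

theorem norm_stdAddChar (j : ZMod q) : ‖(ZMod.stdAddChar j : ℂ)‖ = 1 := by
  rw [AddChar.norm_apply]

theorem norm_phaseState_sq (θ : X → ZMod q) (x : X) :
    ‖phaseState θ x‖ ^ 2 = (Fintype.card X : ℝ)⁻¹ := by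
  rw [phaseState, norm_mul, norm_stdAddChar, mul_one, Complex.norm_real, Real.norm_eq_abs, sq_abs,
    inv_pow, Real.sq_sqrt (Nat.cast_nonneg _)]

theorem sum_norm_phaseState_sq [Nonempty X] (θ : X → ZMod q) : ∑ x, ‖phaseState θ x‖ ^ 2 = 1 := by
  simp_rw [norm_phaseState_sq]
  have : (Fintype.card X : ℝ) ≠ 0 := Nat.cast_ne_zero.2 Fintype.card_ne_zero
  simp [this]

/-- The reflection `1 - 2 |ψ⟩⟨ψ|` applied to `u`. -/
def reflectAlong (ψ u : X → ℂ) (x : X) : ℂ := u x - 2 * ψ x * ∑ y, conj (ψ y) * u y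

theorem norm_overlap_sq_le (ψ u : X → ℂ) (hψ : ∑ x, ‖ψ x‖ ^ 2 = 1) :
    ‖∑ y, conj (ψ y) * u y‖ ^ 2 ≤ ∑ y, ‖u y‖ ^ 2 := by
  calc ‖∑ y, conj (ψ y) * u y‖ ^ 2 ≤ (∑ y, ‖ψ y‖ * ‖u y‖) ^ 2 := by
        gcongr
        refine (norm_sum_le _ _).trans (le_of_eq ?_)
        simp
    _ ≤ (∑ y, ‖ψ y‖ ^ 2) * ∑ y, ‖u y‖ ^ 2 := Finset.sum_mul_sq_le_sq_mul_sq _ _ _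
    _ = _ := by rw [hψ, one_mul]

/-- This isolates the deviations from ideal behaviour. If `⟨φ,u⟩ = conj ρ ⟨ψ,u⟩`, `⟨ψ,v⟩ = ρ ⟨φ,v⟩`
and `⟨ψ,φ⟩ = ρ`, the corrections cancel as `-2ρ - 2ρ + 4ρ = 0`; the coefficient 2 of the reflection
makes this possible. -/
theorem inner_reflectAlong_sub (ψ φ u v : X → ℂ) (ρ : ℂ) :
    (∑ x, conj (reflectAlong ψ u x) * reflectAlong φ v x) - ∑ x, conj (u x) * v x =
      -2 * (∑ x, conj (φ x) * v x) * conj (∑ x, (conj (φ x) - conj ρ * conj (ψ x)) * u x)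
      - 2 * conj (∑ x, conj (ψ x) * u x) * (∑ x, (conj (ψ x) - ρ * conj (φ x)) * v x)
      + 4 * (∑ x, conj (ψ x) * φ x - ρ) * (conj (∑ x, conj (ψ x) * u x) *
        ∑ x, conj (φ x) * v x) := by
  set a := ∑ x, conj (ψ x) * u x with ha
  set b := ∑ x, conj (φ x) * v x with hb
  set c := ∑ x, conj (ψ x) * φ x with hc
  have h1 : (∑ x, (conj (φ x) - conj ρ * conj (ψ x)) * u x) =
      (∑ x, conj (φ x) * u x) - conj ρ * a := by
    rw [ha, Finset.mul_sum, ← Finset.sum_sub_distrib]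
    exact Finset.sum_congr rfl fun x _ => by ring
  have h2 : (∑ x, (conj (ψ x) - ρ * conj (φ x)) * v x) =
      (∑ x, conj (ψ x) * v x) - ρ * b := by
    rw [hb, Finset.mul_sum, ← Finset.sum_sub_distrib]
    exact Finset.sum_congr rfl fun x _ => by ring
  have h3 : conj (∑ x, conj (φ x) * u x) = ∑ x, conj (u x) * φ x := by
    simp [map_sum, mul_comm]
  have h4 : (∑ x, conj (reflectAlong ψ u x) * reflectAlong φ v x) =
      ∑ x, conj (u x) * v x - 2 * b * (∑ x, conj (u x) * φ x) -
        2 * conj a * (∑ x, conj (ψ x) * v x) + 4 * conj a * b * c := by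
    clear_value a b
    rw [hc, Finset.mul_sum, Finset.mul_sum, Finset.mul_sum, ← Finset.sum_sub_distrib,
      ← Finset.sum_sub_distrib, ← Finset.sum_add_distrib]
    refine Finset.sum_congr rfl fun x _ => ?_
    rw [reflectAlong, reflectAlong, ← ha, ← hb]
    simp only [map_sub, map_mul, map_ofNat]
    ring
  rw [h1, h2, h4, map_sub, h3, map_mul, Complex.conj_conj]
  ring

/-- Weighted AM-GM turns each product into squares, whose noise averages are variances. The weight
`s` will be `√N`, which balances squared deviations of average order `1/N`. -/
theorem norm_inner_reflectAlong_sub_le (ψ φ u v : X → ℂ) (ρ : ℝ) (hψ : ∑ x, ‖ψ x‖ ^ 2 = 1)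
    (hφ : ∑ x, ‖φ x‖ ^ 2 = 1) (s : ℝ) (hs : 0 < s) :
    ‖(∑ x, conj (reflectAlong ψ u x) * reflectAlong φ v x) - ∑ x, conj (u x) * v x‖ ≤
      (∑ x, ‖v x‖ ^ 2) / s + s * ‖∑ x, (conj (φ x) - ρ * conj (ψ x)) * u x‖ ^ 2 +
      ((∑ x, ‖u x‖ ^ 2) / s + s * ‖∑ x, (conj (ψ x) - ρ * conj (φ x)) * v x‖ ^ 2) +
      (1 / s + s * ‖∑ x, conj (ψ x) * φ x - ρ‖ ^ 2) * (∑ x, ‖u x‖ ^ 2 + ∑ x, ‖v x‖ ^ 2) := by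
  rw [inner_reflectAlong_sub ψ φ u v ρ, Complex.conj_ofReal]
  have ha := norm_overlap_sq_le ψ u hψ
  have hb := norm_overlap_sq_le φ v hφ
  set a := ‖∑ x, conj (ψ x) * u x‖
  set b := ‖∑ x, conj (φ x) * v x‖
  set e := ‖∑ x, (conj (φ x) - ρ * conj (ψ x)) * u x‖
  set f := ‖∑ x, (conj (ψ x) - ρ * conj (φ x)) * v x‖
  set t := ‖∑ x, conj (ψ x) * φ x - (ρ : ℂ)‖
  set U := ∑ x, ‖u x‖ ^ 2
  set W := ∑ x, ‖v x‖ ^ 2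
  refine (norm_add_le _ _).trans ((add_le_add_left (norm_sub_le _ _) _).trans ?_)
  simp only [norm_mul, Complex.norm_conj, norm_neg, Complex.norm_ofNat]
  have amgm : ∀ y z : ℝ, 2 * y * z ≤ y ^ 2 / s + s * z ^ 2 := by
    intro y z
    have : y ^ 2 / s + s * z ^ 2 - 2 * y * z = (y - s * z) ^ 2 / s := by
      field_simp
      ring
    have h2 : 0 ≤ (y - s * z) ^ 2 / s := by positivity
    linarith
  have t1 : 2 * b * e ≤ W / s + s * e ^ 2 := (amgm b e).trans (by gcongr)
  have t2 : 2 * a * f ≤ U / s + s * f ^ 2 := (amgm a f).trans (by gcongr)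
  have t3 : 2 * t ≤ 1 / s + s * t ^ 2 := by simpa using amgm 1 t
  have t0 : 0 ≤ t := norm_nonneg _
  have t4 : 2 * (a * b) ≤ U + W := by nlinarith [sq_nonneg (a - b)]
  have t5 : 4 * t * (a * b) ≤ (1 / s + s * t ^ 2) * (U + W) := by
    have h1 : 0 ≤ a * b := mul_nonneg (norm_nonneg _) (norm_nonneg _)
    calc 4 * t * (a * b) = (2 * t) * (2 * (a * b)) := by ring
      _ ≤ _ := mul_le_mul t3 t4 (by positivity) (by positivity)
  linarith

theorem sum_comp_add_right (f : (X → ZMod q) → ℝ) (ξ : X → ZMod q) :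
    ∑ θ, f (θ + ξ) = ∑ θ, f θ :=
  Equiv.sum_comp (Equiv.addRight ξ) f

theorem phaseState_add (θ ξ : X → ZMod q) (x : X) :
    phaseState (θ + ξ) x = ZMod.stdAddChar (ξ x) * phaseState θ x := by
  rw [phaseState, phaseState, Pi.add_apply, AddChar.map_add_eq_mul]
  ring

theorem conj_stdAddChar_mul_self (j : ZMod q) :
    conj (ZMod.stdAddChar j) * (ZMod.stdAddChar j : ℂ) = 1 := by
  rw [Complex.conj_mul', norm_stdAddChar]
  simp

theorem conj_phaseState_mul_add [Nonempty X] (θ ξ : X → ZMod q) (x : X) :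
    conj (phaseState θ x) * phaseState (θ + ξ) x =
      ZMod.stdAddChar (ξ x) * (Fintype.card X : ℂ)⁻¹ := by
  rw [phaseState_add, mul_left_comm, Complex.conj_mul']
  congr 1
  have := norm_phaseState_sq θ x
  rw [← Complex.ofReal_pow, this]
  simp

/-- Each deviation is a centred sum of noise phases, so its mean square is at most `1/N` times the
squared norm involved. Translation in `θ` moves terms at `θ + ξ` back to `θ`. The constant is `8 = 4
+ 1 + 1 + 2`. -/
theorem IsPoissonNoise.query_step [Nonempty X] (hw : IsPoissonNoise ρ w) (hq : 2 ≤ q)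
    (u : (X → ZMod q) → X → ℂ) :
    ‖∑ θ, ∑ ξ, (w ξ : ℂ) *
      ((∑ x, conj (reflectAlong (phaseState θ) (u θ) x) *
          reflectAlong (phaseState (θ + ξ)) (u (θ + ξ)) x) -
        ∑ x, conj (u θ x) * u (θ + ξ) x)‖ ≤
      8 / √(Fintype.card X) * ∑ θ, ∑ x, ‖u θ x‖ ^ 2 := by
  have hN : (0 : ℝ) < Fintype.card X := Nat.cast_pos.2 Fintype.card_pos
  set s := √(Fintype.card X : ℝ) with hs
  have hs0 : 0 < s := Real.sqrt_pos.2 hN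
  have hss : s * s = Fintype.card X := Real.mul_self_sqrt hN.le
  set U : (X → ZMod q) → ℝ := fun θ => ∑ x, ‖u θ x‖ ^ 2 with hU
  have hU0 : ∀ θ, 0 ≤ U θ := fun θ => Finset.sum_nonneg fun x _ => sq_nonneg _
  set D : (X → ZMod q) → ℝ := fun ξ =>
    ‖∑ x, (ZMod.stdAddChar (ξ x) - (ρ : ℂ)) * (Fintype.card X : ℂ)⁻¹‖ ^ 2 with hD
  have hDsum : ∑ ξ, w ξ * D ξ ≤ (Fintype.card X : ℝ)⁻¹ := by
    refine (hw.variance_le hq (fun _ => (Fintype.card X : ℂ)⁻¹)).trans (le_of_eq ?_)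
    simp
    field_simp
  set E₁ : (X → ZMod q) → (X → ZMod q) → ℝ := fun θ ξ =>
    ‖∑ x, (conj (ZMod.stdAddChar (ξ x)) - (ρ : ℂ)) * (conj (phaseState θ x) * u θ x)‖ ^ 2 with hE₁
  set E₂ : (X → ZMod q) → (X → ZMod q) → ℝ := fun θ ξ =>
    ‖∑ x, (ZMod.stdAddChar (ξ x) - (ρ : ℂ)) * (conj (phaseState θ x) * u θ x)‖ ^ 2 with hE₂
  have hz : ∀ θ : X → ZMod q,
      ∑ x, ‖conj (phaseState θ x) * u θ x‖ ^ 2 = (Fintype.card X : ℝ)⁻¹ * U θ := by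
    intro θ
    rw [hU, Finset.mul_sum]
    refine Finset.sum_congr rfl fun x _ => ?_
    rw [norm_mul, Complex.norm_conj, mul_pow, norm_phaseState_sq]
  have hE₁s : ∀ θ, ∑ ξ, w ξ * E₁ θ ξ ≤ (Fintype.card X : ℝ)⁻¹ * U θ := fun θ =>
    (hw.variance_conj_le hq _).trans (le_of_eq (hz θ))
  have hE₂s : ∀ θ, ∑ ξ, w ξ * E₂ θ ξ ≤ (Fintype.card X : ℝ)⁻¹ * U θ := fun θ =>
    (hw.variance_le hq _).trans (le_of_eq (hz θ))
  have pt : ∀ θ ξ, ‖(w ξ : ℂ) *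
      ((∑ x, conj (reflectAlong (phaseState θ) (u θ) x) *
          reflectAlong (phaseState (θ + ξ)) (u (θ + ξ)) x) -
        ∑ x, conj (u θ x) * u (θ + ξ) x)‖ ≤
      w ξ * (U (θ + ξ) / s + s * E₁ θ ξ + (U θ / s + s * E₂ (θ + ξ) ξ) +
        (1 / s + s * D ξ) * (U θ + U (θ + ξ))) := by
    intro θ ξ
    rw [norm_mul, Complex.norm_real, Real.norm_of_nonneg (hw.nonneg ξ)]
    refine mul_le_mul_of_nonneg_left ?_ (hw.nonneg ξ)
    refine (norm_inner_reflectAlong_sub_le (phaseState θ) (phaseState (θ + ξ)) (u θ) (u (θ + ξ)) ρ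
      (sum_norm_phaseState_sq θ) (sum_norm_phaseState_sq _) s hs0).trans (le_of_eq ?_)
    have e1 : ∑ x, (conj (phaseState (θ + ξ) x) - ρ * conj (phaseState θ x)) * u θ x =
        ∑ x, (conj (ZMod.stdAddChar (ξ x)) - (ρ : ℂ)) * (conj (phaseState θ x) * u θ x) := by
      refine Finset.sum_congr rfl fun x _ => ?_
      rw [phaseState_add, map_mul]
      ring
    have e2 : ∑ x, (conj (phaseState θ x) - ρ * conj (phaseState (θ + ξ) x)) * u (θ + ξ) x =
        ∑ x, (ZMod.stdAddChar (ξ x) - (ρ : ℂ)) *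
          (conj (phaseState (θ + ξ) x) * u (θ + ξ) x) := by
      refine Finset.sum_congr rfl fun x _ => ?_
      have := conj_stdAddChar_mul_self (ξ x)
      rw [phaseState_add, map_mul]
      linear_combination (-conj (phaseState θ x) * u (θ + ξ) x) * this
    have e3 : ∑ x, conj (phaseState θ x) * phaseState (θ + ξ) x - (ρ : ℂ) =
        ∑ x, (ZMod.stdAddChar (ξ x) - (ρ : ℂ)) * (Fintype.card X : ℂ)⁻¹ := by
      simp_rw [conj_phaseState_mul_add, sub_mul]
      rw [Finset.sum_sub_distrib]
      congr 1
      have : (Fintype.card X : ℂ) ≠ 0 := Nat.cast_ne_zero.2 Fintype.card_ne_zero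
      simp
      field_simp
    rw [e1, e2, e3]
  have hw1 := hw.sum_eq_one
  set 𝒰 := ∑ θ, U θ with h𝒰
  have h𝒰0 : 0 ≤ 𝒰 := Finset.sum_nonneg fun θ _ => hU0 θ
  have total : ∑ θ, ∑ ξ, w ξ * (U (θ + ξ) / s + s * E₁ θ ξ + (U θ / s + s * E₂ (θ + ξ) ξ) +
        (1 / s + s * D ξ) * (U θ + U (θ + ξ))) =
      4 * (𝒰 / s) + s * (∑ θ, ∑ ξ, w ξ * E₁ θ ξ) + s * (∑ θ, ∑ ξ, w ξ * E₂ θ ξ) +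
        2 * s * (∑ ξ, w ξ * D ξ) * 𝒰 := by
    have r1 : ∑ θ, ∑ ξ, w ξ * U θ = 𝒰 := by
      simp_rw [← Finset.sum_mul, hw1, one_mul]
      rfl
    have r2 : ∑ θ, ∑ ξ, w ξ * U (θ + ξ) = 𝒰 := by
      rw [Finset.sum_comm]
      simp_rw [← Finset.mul_sum, sum_comp_add_right U, ← Finset.sum_mul, hw1, one_mul]
      rfl
    have r3 : ∑ θ, ∑ ξ, w ξ * E₂ (θ + ξ) ξ = ∑ θ, ∑ ξ, w ξ * E₂ θ ξ := by
      rw [Finset.sum_comm, Finset.sum_comm (f := fun θ ξ => w ξ * E₂ θ ξ)]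
      refine Finset.sum_congr rfl fun ξ _ => ?_
      exact sum_comp_add_right (fun θ => w ξ * E₂ θ ξ) ξ
    have r4 : ∑ θ, ∑ ξ, w ξ * D ξ * U θ = (∑ ξ, w ξ * D ξ) * 𝒰 := by
      rw [h𝒰, Finset.mul_sum]
      simp_rw [Finset.sum_mul]
    have r5 : ∑ θ, ∑ ξ, w ξ * D ξ * U (θ + ξ) = (∑ ξ, w ξ * D ξ) * 𝒰 := by
      rw [Finset.sum_comm]
      simp_rw [← Finset.mul_sum, sum_comp_add_right U, ← Finset.sum_mul]
      rfl
    have e : ∀ θ ξ, w ξ * (U (θ + ξ) / s + s * E₁ θ ξ + (U θ / s + s * E₂ (θ + ξ) ξ) +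
        (1 / s + s * D ξ) * (U θ + U (θ + ξ))) =
        2 / s * (w ξ * U θ) + 2 / s * (w ξ * U (θ + ξ)) + s * (w ξ * E₁ θ ξ) +
        s * (w ξ * E₂ (θ + ξ) ξ) + s * (w ξ * D ξ * U θ) + s * (w ξ * D ξ * U (θ + ξ)) := by
      intro θ ξ
      field_simp
      ring
    simp_rw [e, Finset.sum_add_distrib, ← Finset.mul_sum]
    rw [r1, r2, r3, r4, r5]
    ring
  calc _ ≤ ∑ θ, ∑ ξ, w ξ * (U (θ + ξ) / s + s * E₁ θ ξ + (U θ / s + s * E₂ (θ + ξ) ξ) +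
        (1 / s + s * D ξ) * (U θ + U (θ + ξ))) :=
        (norm_sum_le _ _).trans (Finset.sum_le_sum fun θ _ =>
          (norm_sum_le _ _).trans (Finset.sum_le_sum fun ξ _ => pt θ ξ))
    _ = _ := total
    _ ≤ 4 * (𝒰 / s) + s * ((Fintype.card X : ℝ)⁻¹ * 𝒰) + s * ((Fintype.card X : ℝ)⁻¹ * 𝒰) +
        2 * s * (Fintype.card X : ℝ)⁻¹ * 𝒰 := by
      have a1 : (∑ θ, ∑ ξ, w ξ * E₁ θ ξ) ≤ (Fintype.card X : ℝ)⁻¹ * 𝒰 := by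
        rw [h𝒰, Finset.mul_sum]
        exact Finset.sum_le_sum fun θ _ => hE₁s θ
      have a2 : (∑ θ, ∑ ξ, w ξ * E₂ θ ξ) ≤ (Fintype.card X : ℝ)⁻¹ * 𝒰 := by
        rw [h𝒰, Finset.mul_sum]
        exact Finset.sum_le_sum fun θ _ => hE₂s θ
      gcongr
    _ = 8 / s * 𝒰 := by
      rw [← hss]
      field_simp
      ring

end query

/-! ### Few excitations cannot be spread over many registers -/

section sector

variable {ι : Type*} [Fintype ι] [DecidableEq ι] {X : Type*} [Fintype X] [DecidableEq X]
variable {q : ℕ} [NeZero q]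

/-- Exchanging `x` with `o i` is an involution on the pairs `(o, x)`. -/
theorem sum_sum_update {M : Type*} [AddCommMonoid M] (i : ι) (f : (ι → X) → M) :
    ∑ o, ∑ x, f (Function.update o i x) = Fintype.card X • ∑ o, f o := by
  have hinv : Function.Involutive
      (fun p : (ι → X) × X => (Function.update p.1 i p.2, p.1 i)) := by
    rintro ⟨o, x⟩
    simp
  have h := Equiv.sum_comp hinv.toPerm (fun p : (ι → X) × X => f p.1)
  simp only [Function.Involutive.coe_toPerm, Fintype.sum_prod_type] at h
  rw [h]
  simp [Finset.sum_nsmul]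

/-- The sum of the standard representatives of the entries. -/
def valSum (α : X → ZMod q) : ℕ := ∑ x, (α x).val

theorem valSum_add_single {β : X → ZMod q} {x : X} (h : β x ≠ -1) :
    valSum (β + Pi.single x 1) = valSum β + 1 := by
  have hq : (β x).val + 1 < q := by
    have h1 := ZMod.val_lt (β x)
    by_contra h2
    have h3 : (β x).val + 1 = q := by omega
    apply h
    have h4 : ((β x).val + 1 : ZMod q) = 0 := by
      have := congrArg (Nat.cast (R := ZMod q)) h3
      simpa using this
    rw [ZMod.natCast_zmod_val] at h4
    exact eq_neg_of_add_eq_zero_left h4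
  have h1q : (1 : ZMod q).val = 1 := ZMod.val_one'' (by omega)
  have hy : ∀ y, ((β + Pi.single x 1 : X → ZMod q) y).val =
      (β y).val + if y = x then 1 else 0 := by
    intro y
    by_cases hyx : y = x
    · subst hyx
      rw [Pi.add_apply, Pi.single_eq_same, ZMod.val_add_of_lt (by rw [h1q]; exact hq), h1q,
        if_pos rfl]
    · simp [hyx]
  rw [valSum, valSum]
  simp_rw [hy]
  rw [Finset.sum_add_distrib]
  simp

/-- An unexpected total can only come from wrap-around, so `β x = -1`. Adding at another point would
keep this entry, whose representative `q - 1` already exceeds `k`. -/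
theorem eq_of_valSum_add_single {β : X → ZMod q} {k : ℕ} (hk : k + 1 < q)
    (hβ : valSum β + 1 ≠ k) {x y : X} (hx : valSum (β + Pi.single x 1) = k)
    (hy : valSum (β + Pi.single y 1) = k) : x = y := by
  by_contra hxy
  have h1 : β x = -1 := by
    by_contra h
    exact hβ ((valSum_add_single h).symm.trans hx)
  have h2 : (β + Pi.single y 1 : X → ZMod q) x = -1 := by
    rw [Pi.add_apply, Pi.single_eq_of_ne hxy, add_zero, h1]
  have h3 : ((β + Pi.single y 1 : X → ZMod q) x).val ≤ valSum (β + Pi.single y 1) :=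
    Finset.single_le_sum (f := fun z => ((β + Pi.single y 1 : X → ZMod q) z).val)
      (fun _ _ => Nat.zero_le _) (Finset.mem_univ x)
  rw [h2, hy] at h3
  obtain ⟨r, rfl⟩ : ∃ r, q = r + 1 := ⟨q - 1, by omega⟩
  rw [ZMod.val_neg_one] at h3
  omega

/-- Removes one excitation from the `i`-th register (up to normalization, and constantly extended
to the values of the `i`-th register). -/
def lower (χ : (X → ZMod q) → (ι → X) → ℂ) (i : ι) (β : X → ZMod q) (o : ι → X) : ℂ :=
  ∑ x, χ (β + Pi.single x 1) (Function.update o i x)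

/-- The squared norm of a family of amplitudes. -/
noncomputable def ampSq (χ : (X → ZMod q) → (ι → X) → ℂ) : ℝ := ∑ α, ∑ o, ‖χ α o‖ ^ 2

theorem ampSq_nonneg (χ : (X → ZMod q) → (ι → X) → ℂ) : 0 ≤ ampSq χ :=
  Finset.sum_nonneg fun _ _ => Finset.sum_nonneg fun _ _ => sq_nonneg _

theorem lower_update (χ : (X → ZMod q) → (ι → X) → ℂ) (i : ι) (β : X → ZMod q) (o : ι → X)
    (x : X) : lower χ i β (Function.update o i x) = lower χ i β o := by
  simp [lower]

theorem sum_comp_sub (f : (X → ZMod q) → ℂ) (ξ : X → ZMod q) :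
    ∑ θ, f (θ - ξ) = ∑ θ, f θ :=
  Equiv.sum_comp (Equiv.subRight ξ) f

theorem sum_sum_comp_sub (s : (ι → X) → (X → ZMod q)) (f : (X → ZMod q) → (ι → X) → ℂ) :
    ∑ α, ∑ o, f (α - s o) o = ∑ α, ∑ o, f α o := by
  rw [Finset.sum_comm, Finset.sum_comm (f := f)]
  exact Finset.sum_congr rfl fun o _ => sum_comp_sub (fun α => f α o) (s o)

theorem sum_sum_mul_sq_le {A B : Type*} [Fintype A] [Fintype B] (f g : A → B → ℝ) :
    (∑ a, ∑ b, f a b * g a b) ^ 2 ≤ (∑ a, ∑ b, f a b ^ 2) * ∑ a, ∑ b, g a b ^ 2 := by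
  have h := Finset.sum_mul_sq_le_sq_mul_sq Finset.univ
    (fun p : A × B => f p.1 p.2) (fun p => g p.1 p.2)
  simpa only [Fintype.sum_prod_type] using h

/-- For a wrapped index the sum in `lower` has at most one nonzero term, so no Cauchy-Schwarz over
`X` is needed: the cost is `N` instead of the general `N²` of `ampSq_lower_le`. -/
theorem sum_lower_boundary_le {k : ℕ} (hk : k + 1 < q) (χ : (X → ZMod q) → (ι → X) → ℂ)
    (hχ : ∀ α o, χ α o ≠ 0 → valSum α = k) (i : ι) :
    ∑ β, ∑ o, ‖if valSum β + 1 = k then 0 else lower χ i β o‖ ^ 2 ≤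
      Fintype.card X * ampSq χ := by
  have pt : ∀ β o, ‖if valSum β + 1 = k then 0 else lower χ i β o‖ ^ 2 ≤
      ∑ x, ‖χ (β + Pi.single x 1) (Function.update o i x)‖ ^ 2 := by
    intro β o
    split_ifs with hβ
    · simp only [norm_zero, ne_eq, OfNat.ofNat_ne_zero, not_false_eq_true, zero_pow]
      positivity
    · by_cases hex : ∃ x, χ (β + Pi.single x 1) (Function.update o i x) ≠ 0
      · obtain ⟨x, hx⟩ := hex
        rw [lower, Finset.sum_eq_single x]
        · exact Finset.single_le_sum
            (f := fun x => ‖χ (β + Pi.single x 1) (Function.update o i x)‖ ^ 2)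
            (fun _ _ => sq_nonneg _) (Finset.mem_univ x)
        · intro y _ hyx
          by_contra hy
          exact hyx (eq_of_valSum_add_single hk hβ (hχ _ _ hy) (hχ _ _ hx))
        · simp
      · push Not at hex
        rw [lower, Finset.sum_eq_zero fun x _ => hex x]
        simp only [norm_zero, ne_eq, OfNat.ofNat_ne_zero, not_false_eq_true, zero_pow]
        positivity
  calc _ ≤ ∑ β : X → ZMod q, ∑ o : ι → X,
        ∑ x, ‖χ (β + Pi.single x 1) (Function.update o i x)‖ ^ 2 :=
        Finset.sum_le_sum fun β _ => Finset.sum_le_sum fun o _ => pt β o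
    _ = ∑ o : ι → X, ∑ x, ∑ α, ‖χ α (Function.update o i x)‖ ^ 2 := by
      rw [Finset.sum_comm]
      refine Finset.sum_congr rfl fun o _ => ?_
      rw [Finset.sum_comm]
      refine Finset.sum_congr rfl fun x _ => ?_
      exact sum_comp_add_right (fun α => ‖χ α (Function.update o i x)‖ ^ 2) (Pi.single x 1)
    _ = _ := by
      rw [sum_sum_update i (fun o => ∑ α, ‖χ α o‖ ^ 2), nsmul_eq_mul, Finset.sum_comm, ampSq]

/-- Shifting the index turns the overlap of two raised vectors into that of two vectors lowered in
the other register. The factor `N²` appears because `v i` ignores register `i` and `v j` ignores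
register `j`. -/
theorem norm_sum_cross_le [Nonempty X] (v : ι → (X → ZMod q) → (ι → X) → ℂ)
    (hv : ∀ i β o x, v i β (Function.update o i x) = v i β o) {i j : ι} (hij : i ≠ j) :
    (Fintype.card X : ℝ) ^ 2 * ‖∑ α : X → ZMod q, ∑ o : ι → X, conj (v i (α - Pi.single (o i) 1) o) *
      v j (α - Pi.single (o j) 1) o‖ ≤ (ampSq (lower (v i) j) + ampSq (lower (v j) i)) / 2 := by
  have e : ((Fintype.card X : ℂ) ^ 2) * ∑ α : X → ZMod q, ∑ o : ι → X, conj (v i (α - Pi.single (o i) 1) o) *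
      v j (α - Pi.single (o j) 1) o =
      ∑ γ : X → ZMod q, ∑ o : ι → X, conj (lower (v i) j γ o) * lower (v j) i γ o := by
    have h1 : ∑ α : X → ZMod q, ∑ o : ι → X, conj (v i (α - Pi.single (o i) 1) o) * v j (α - Pi.single (o j) 1) o =
        ∑ γ : X → ZMod q, ∑ o : ι → X, conj (v i (γ + Pi.single (o j) 1) o) * v j (γ + Pi.single (o i) 1) o := by
      refine Eq.trans ?_
        (sum_sum_comp_sub (fun o : ι → X => (Pi.single (o i) 1 + Pi.single (o j) 1 : X → ZMod q))
        (fun γ o => conj (v i (γ + Pi.single (o j) 1) o) * v j (γ + Pi.single (o i) 1) o))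
      refine Finset.sum_congr rfl fun α _ => Finset.sum_congr rfl fun o _ => ?_
      have e1 : α - (Pi.single (o i) 1 + Pi.single (o j) 1) + Pi.single (o j) 1 =
          α - Pi.single (o i) 1 := by abel
      have e2 : α - (Pi.single (o i) 1 + Pi.single (o j) 1) + Pi.single (o i) 1 =
          α - Pi.single (o j) 1 := by abel
      simp only [e1, e2]
    rw [h1, Finset.mul_sum]
    refine Finset.sum_congr rfl fun γ _ => ?_
    set G : (ι → X) → ℂ := fun o =>
      conj (v i (γ + Pi.single (o j) 1) o) * v j (γ + Pi.single (o i) 1) o with hG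
    have h2 : ∑ o, ∑ x, ∑ y, G (Function.update (Function.update o i x) j y) =
        (Fintype.card X : ℂ) ^ 2 * ∑ o, G o := by
      rw [sum_sum_update i (fun o => ∑ y, G (Function.update o j y)), sum_sum_update j G,
        nsmul_eq_mul, nsmul_eq_mul]
      ring
    rw [← h2]
    refine Finset.sum_congr rfl fun o _ => ?_
    rw [lower, lower, map_sum, Finset.sum_mul_sum, Finset.sum_comm]
    refine Finset.sum_congr rfl fun y _ => Finset.sum_congr rfl fun x _ => ?_
    rw [hG]
    simp only [Function.update_self, Function.update_of_ne hij]
    rw [hv j, Function.update_comm hij, hv i]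
  have e' := congrArg norm e
  rw [norm_mul, norm_pow, Complex.norm_natCast] at e'
  rw [e']
  calc _ ≤ ∑ γ : X → ZMod q, ∑ o : ι → X, ‖conj (lower (v i) j γ o) * lower (v j) i γ o‖ :=
        (norm_sum_le _ _).trans (Finset.sum_le_sum fun γ _ => norm_sum_le _ _)
    _ ≤ ∑ γ : X → ZMod q, ∑ o : ι → X, (‖lower (v i) j γ o‖ ^ 2 + ‖lower (v j) i γ o‖ ^ 2) / 2 := by
      refine Finset.sum_le_sum fun γ _ => Finset.sum_le_sum fun o _ => ?_
      rw [norm_mul, Complex.norm_conj]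
      nlinarith [sq_nonneg (‖lower (v i) j γ o‖ - ‖lower (v j) i γ o‖)]
    _ = _ := by
      simp_rw [← Finset.sum_div, Finset.sum_add_distrib]
      rfl

theorem sum_normSq_raise_le [Nonempty X] (v : ι → (X → ZMod q) → (ι → X) → ℂ)
    (hv : ∀ i β o x, v i β (Function.update o i x) = v i β o) (m : ℝ)
    (hm : ∀ i, ∑ j, ampSq (lower (v i) j) ≤ (Fintype.card X : ℝ) ^ 2 * m * ampSq (v i)) :
    ∑ α : X → ZMod q, ∑ o : ι → X, ‖∑ i, v i (α - Pi.single (o i) 1) o‖ ^ 2 ≤ (1 + m) * ∑ i, ampSq (v i) := by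
  have hN : (0 : ℝ) < (Fintype.card X : ℝ) ^ 2 := by
    have : (0 : ℝ) < Fintype.card X := Nat.cast_pos.2 Fintype.card_pos
    positivity
  set t : ι → ι → ℂ := fun i j => ∑ α : X → ZMod q, ∑ o : ι → X, conj (v i (α - Pi.single (o i) 1) o) *
      v j (α - Pi.single (o j) 1) o with ht
  have hdiag : ∀ i, ‖t i i‖ ≤ ampSq (v i) := by
    intro i
    have h1 : t i i = ((ampSq (v i) : ℝ) : ℂ) := by
      rw [ht, ampSq]
      push_cast
      simp_rw [Complex.conj_mul']
      exact sum_sum_comp_sub (fun o : ι → X => (Pi.single (o i) 1 : X → ZMod q))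
        (fun α o => (‖v i α o‖ : ℂ) ^ 2)
    rw [h1, Complex.norm_real, Real.norm_of_nonneg (ampSq_nonneg _)]
  -- The diagonal is charged the nonnegative cross term as well, so that the sum over `j` in `hm`
  -- can run over every register.
  have hall : ∀ i j, ‖t i j‖ ≤ (if i = j then ampSq (v i) else 0) +
      ((Fintype.card X : ℝ) ^ 2)⁻¹ *
        ((ampSq (lower (v i) j) + ampSq (lower (v j) i)) / 2) := by
    intro i j
    have h0 : 0 ≤ ((Fintype.card X : ℝ) ^ 2)⁻¹ *
        ((ampSq (lower (v i) j) + ampSq (lower (v j) i)) / 2) :=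
      mul_nonneg (by positivity)
        (div_nonneg (add_nonneg (ampSq_nonneg _) (ampSq_nonneg _)) (by norm_num))
    split_ifs with h
    · subst h
      linarith [hdiag i]
    · rw [zero_add, ← div_eq_inv_mul, le_div_iff₀ hN, mul_comm]
      exact norm_sum_cross_le v hv h
  have hsum : ((∑ α : X → ZMod q, ∑ o : ι → X, ‖∑ i, v i (α - Pi.single (o i) 1) o‖ ^ 2 : ℝ) : ℂ) =
      ∑ i, ∑ j, t i j := by
    push_cast
    have e1 : ∀ (α : X → ZMod q) (o : ι → X), ((‖∑ i, v i (α - Pi.single (o i) 1) o‖ : ℝ) : ℂ) ^ 2 =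
        ∑ i, ∑ j, conj (v i (α - Pi.single (o i) 1) o) * v j (α - Pi.single (o j) 1) o := by
      intro α o
      rw [← Complex.conj_mul', map_sum, Finset.sum_mul_sum]
    simp_rw [e1, ht]
    have e2 : ∀ α : X → ZMod q, ∑ o : ι → X, ∑ i, ∑ j,
        conj (v i (α - Pi.single (o i) 1) o) * v j (α - Pi.single (o j) 1) o =
        ∑ i, ∑ j, ∑ o : ι → X,
          conj (v i (α - Pi.single (o i) 1) o) * v j (α - Pi.single (o j) 1) o := by
      intro α
      rw [Finset.sum_comm]
      exact Finset.sum_congr rfl fun i _ => Finset.sum_comm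
    simp_rw [e2]
    rw [Finset.sum_comm]
    exact Finset.sum_congr rfl fun i _ => Finset.sum_comm
  calc _ = ‖∑ i, ∑ j, t i j‖ := by
        rw [← hsum, Complex.norm_real, Real.norm_of_nonneg]
        exact Finset.sum_nonneg fun _ _ => Finset.sum_nonneg fun _ _ => sq_nonneg _
    _ ≤ ∑ i, ∑ j, ‖t i j‖ :=
        (norm_sum_le _ _).trans (Finset.sum_le_sum fun i _ => norm_sum_le _ _)
    _ ≤ ∑ i, ∑ j, ((if i = j then ampSq (v i) else 0) + ((Fintype.card X : ℝ) ^ 2)⁻¹ *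
        ((ampSq (lower (v i) j) + ampSq (lower (v j) i)) / 2)) :=
        Finset.sum_le_sum fun i _ => Finset.sum_le_sum fun j _ => hall i j
    _ = ∑ i, ampSq (v i) + ((Fintype.card X : ℝ) ^ 2)⁻¹ *
        ∑ i, ∑ j, ampSq (lower (v i) j) := by
      simp_rw [Finset.sum_add_distrib, ← Finset.mul_sum, ← Finset.sum_div,
        Finset.sum_add_distrib]
      rw [Finset.sum_comm (f := fun i j => ampSq (lower (v j) i))]
      simp
    _ ≤ ∑ i, ampSq (v i) + ((Fintype.card X : ℝ) ^ 2)⁻¹ *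
        ∑ i, (Fintype.card X : ℝ) ^ 2 * m * ampSq (v i) := by
      gcongr with i
      exact hm i
    _ = _ := by
      simp_rw [mul_assoc, ← Finset.mul_sum]
      rw [inv_mul_cancel_left₀ hN.ne']
      ring

/-- Duality: `S = ∑ ampSq (v i)` equals `N` times the overlap of the raised vector with `χ`.
Cauchy-Schwarz gives `S² ≤ N² T ampSq χ`, and `T ≤ (1 + m) S` lets one factor `S` cancel. -/
theorem sum_ampSq_le_of_raise [Nonempty X] (χ : (X → ZMod q) → (ι → X) → ℂ)
    (v : ι → (X → ZMod q) → (ι → X) → ℂ)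
    (hv : ∀ i β o x, v i β (Function.update o i x) = v i β o)
    (hχ : ∀ i β o, v i β o = 0 ∨ v i β o = lower χ i β o) (m : ℝ)
    (hm0 : 0 ≤ m)
    (hm : ∀ i, ∑ j, ampSq (lower (v i) j) ≤ (Fintype.card X : ℝ) ^ 2 * m * ampSq (v i)) :
    ∑ i, ampSq (v i) ≤ (Fintype.card X : ℝ) ^ 2 * (1 + m) * ampSq χ := by
  have hT := sum_normSq_raise_le v hv m hm
  set S := ∑ i, ampSq (v i) with hS
  set T := ∑ α : X → ZMod q, ∑ o : ι → X, ‖∑ i, v i (α - Pi.single (o i) 1) o‖ ^ 2 with hTdef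
  have hS0 : 0 ≤ S := Finset.sum_nonneg fun i _ => ampSq_nonneg _
  have e : (S : ℂ) = Fintype.card X *
      ∑ α : X → ZMod q, ∑ o : ι → X, conj (∑ i, v i (α - Pi.single (o i) 1) o) * χ α o := by
    have h1 : ∀ i, ((ampSq (v i) : ℝ) : ℂ) = Fintype.card X *
        ∑ α : X → ZMod q, ∑ o : ι → X, conj (v i (α - Pi.single (o i) 1) o) * χ α o := by
      intro i
      have h2 : ((ampSq (v i) : ℝ) : ℂ) = ∑ β, ∑ o, conj (v i β o) * lower χ i β o := by
        rw [ampSq]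
        push_cast
        refine Finset.sum_congr rfl fun β _ => Finset.sum_congr rfl fun o _ => ?_
        rw [← Complex.conj_mul']
        rcases hχ i β o with h | h
        · simp [h]
        · rw [h]
      have h3 : ∀ β : X → ZMod q, ∑ o : ι → X, conj (v i β o) * lower χ i β o =
          Fintype.card X * ∑ o, conj (v i β o) * χ (β + Pi.single (o i) 1) o := by
        intro β
        have h4 := sum_sum_update i (fun o => conj (v i β o) * χ (β + Pi.single (o i) 1) o)
        rw [nsmul_eq_mul] at h4
        rw [← h4]
        refine Finset.sum_congr rfl fun o _ => ?_
        rw [lower, Finset.mul_sum]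
        refine Finset.sum_congr rfl fun x _ => ?_
        rw [hv, Function.update_self]
      rw [h2]
      simp_rw [h3]
      rw [← Finset.mul_sum]
      congr 1
      refine (sum_sum_comp_sub (fun o : ι → X => (Pi.single (o i) 1 : X → ZMod q))
        (fun β o => conj (v i β o) * χ (β + Pi.single (o i) 1) o)).symm.trans ?_
      simp
    rw [hS]
    push_cast
    simp_rw [h1]
    rw [← Finset.mul_sum, Finset.sum_comm]
    congr 1
    refine Finset.sum_congr rfl fun α _ => ?_
    rw [Finset.sum_comm]
    refine Finset.sum_congr rfl fun o _ => ?_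
    rw [map_sum, Finset.sum_mul]
  have hCS : S ^ 2 ≤ (Fintype.card X : ℝ) ^ 2 * (T * ampSq χ) := by
    have h1 : S ≤ Fintype.card X *
        ∑ α : X → ZMod q, ∑ o : ι → X, ‖∑ i, v i (α - Pi.single (o i) 1) o‖ * ‖χ α o‖ := by
      have := congrArg norm e
      rw [Complex.norm_real, Real.norm_of_nonneg hS0, norm_mul, Complex.norm_natCast] at this
      rw [this]
      gcongr
      refine (norm_sum_le _ _).trans (Finset.sum_le_sum fun α _ =>
        (norm_sum_le _ _).trans (le_of_eq (Finset.sum_congr rfl fun o _ => ?_)))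
      rw [norm_mul, Complex.norm_conj]
    have h2 := pow_le_pow_left₀ hS0 h1 2
    rw [mul_pow] at h2
    exact h2.trans (mul_le_mul_of_nonneg_left
      (sum_sum_mul_sq_le (fun (α : X → ZMod q) (o : ι → X) =>
        ‖∑ i, v i (α - Pi.single (o i) 1) o‖) (fun α o => ‖χ α o‖)) (sq_nonneg _))
  have hA := ampSq_nonneg χ
  clear_value S T
  rcases hS0.eq_or_lt with h0 | h0
  · rw [← h0]
    positivity
  · have h2 : S * S ≤ ((Fintype.card X : ℝ) ^ 2 * (1 + m) * ampSq χ) * S := by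
      have h3 := mul_le_mul_of_nonneg_left (mul_le_mul_of_nonneg_right hT hA)
        (sq_nonneg (Fintype.card X : ℝ))
      linarith
    exact le_of_mul_le_mul_right h2 h0

/-- Lowering leaves one excitation fewer, except at wrapped indices. The regular part obeys the
induction hypothesis and is handled by duality; the wrapped part costs `ℓ/N`. The constants
therefore satisfy `m_(k+1) = 1 + m_k + ℓ/N`. -/
theorem sum_ampSq_lower_le [Nonempty X] (k : ℕ) (hk : k + 1 < q)
    (χ : (X → ZMod q) → (ι → X) → ℂ) (hχ : ∀ α o, χ α o ≠ 0 → valSum α = k) :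
    ∑ i, ampSq (lower χ i) ≤ (Fintype.card X : ℝ) ^ 2 *
      (k + (k + 1) * Fintype.card ι / Fintype.card X) * ampSq χ := by
  have hN : (0 : ℝ) < Fintype.card X := Nat.cast_pos.2 Fintype.card_pos
  induction k generalizing χ with
  | zero =>
    -- With no excitations every index is wrapped, since `valSum β + 1` is never `0`.
    have h1 : ∀ i, ampSq (lower χ i) ≤ Fintype.card X * ampSq χ := by
      intro i
      simpa [ampSq] using sum_lower_boundary_le hk χ hχ i
    calc _ ≤ ∑ _i : ι, Fintype.card X * ampSq χ := Finset.sum_le_sum fun i _ => h1 i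
      _ = _ := by
        simp
        field_simp
  | succ k ih =>
    set v : ι → (X → ZMod q) → (ι → X) → ℂ := fun i β o =>
      if valSum β + 1 = k + 1 then lower χ i β o else 0 with hv
    set b : ι → (X → ZMod q) → (ι → X) → ℂ := fun i β o =>
      if valSum β + 1 = k + 1 then 0 else lower χ i β o with hb
    have hsplit : ∀ i, ampSq (lower χ i) = ampSq (v i) + ampSq (b i) := by
      intro i
      rw [ampSq, ampSq, ampSq, ← Finset.sum_add_distrib]
      refine Finset.sum_congr rfl fun β _ => ?_
      rw [← Finset.sum_add_distrib]
      refine Finset.sum_congr rfl fun o _ => ?_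
      rw [hv, hb]
      by_cases h : valSum β + 1 = k + 1 <;> simp only [h, if_true, if_false] <;> simp
    have hbb : ∀ i, ampSq (b i) ≤ Fintype.card X * ampSq χ := fun i =>
      sum_lower_boundary_le hk χ hχ i
    have hvv := sum_ampSq_le_of_raise χ v
      (by
        intro i β o x
        simp only [hv, lower_update])
      (by
        intro i β o
        rw [hv]
        by_cases h : valSum β + 1 = k + 1 <;> simp only [h, if_true, if_false] <;> simp)
      (k + (k + 1) * Fintype.card ι / Fintype.card X) (by positivity)
      (fun i => ih (by omega) (v i) (by
        intro α o h
        by_contra h2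
        apply h
        simp only [hv]
        rw [if_neg (by omega)]))
    simp_rw [hsplit, Finset.sum_add_distrib]
    calc _ ≤ (Fintype.card X : ℝ) ^ 2 * (1 + (k + (k + 1) * Fintype.card ι / Fintype.card X)) *
          ampSq χ + ∑ _i : ι, Fintype.card X * ampSq χ :=
          add_le_add hvv (Finset.sum_le_sum fun i _ => hbb i)
      _ = _ := by
        simp
        field_simp
        ring

end sector

/-! ### Expected number of copies in terms of Fourier coefficients -/

section copies

variable {ι : Type*} [Fintype ι] [DecidableEq ι] {X : Type*} [Fintype X] [DecidableEq X]
variable {q : ℕ} [NeZero q]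

theorem lower_add (χ χ' : (X → ZMod q) → (ι → X) → ℂ) (i : ι) (β : X → ZMod q) (o : ι → X) :
    lower (χ + χ') i β o = lower χ i β o + lower χ' i β o := by
  simp [lower, Finset.sum_add_distrib]

theorem ampSq_lower_le (χ : (X → ZMod q) → (ι → X) → ℂ) (i : ι) :
    ampSq (lower χ i) ≤ (Fintype.card X : ℝ) ^ 2 * ampSq χ := by
  have pt : ∀ β o, ‖lower χ i β o‖ ^ 2 ≤
      Fintype.card X * ∑ x, ‖χ (β + Pi.single x 1) (Function.update o i x)‖ ^ 2 := by
    intro β o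
    calc ‖lower χ i β o‖ ^ 2 ≤
        (∑ x, ‖χ (β + Pi.single x 1) (Function.update o i x)‖) ^ 2 := by
          gcongr
          exact norm_sum_le _ _
      _ ≤ _ := by
        have := sq_sum_le_card_mul_sum_sq (s := Finset.univ)
          (f := fun x => ‖χ (β + Pi.single x 1) (Function.update o i x)‖)
        simpa using this
  calc ampSq (lower χ i) ≤ ∑ β : X → ZMod q, ∑ o : ι → X, (Fintype.card X : ℝ) *
        ∑ x, ‖χ (β + Pi.single x 1) (Function.update o i x)‖ ^ 2 :=
        Finset.sum_le_sum fun β _ => Finset.sum_le_sum fun o _ => pt β o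
    _ = (Fintype.card X : ℝ) * ∑ o : ι → X, ∑ x, ∑ α, ‖χ α (Function.update o i x)‖ ^ 2 := by
      simp_rw [← Finset.mul_sum]
      congr 1
      rw [Finset.sum_comm]
      refine Finset.sum_congr rfl fun o _ => ?_
      rw [Finset.sum_comm]
      refine Finset.sum_congr rfl fun x _ => ?_
      exact sum_comp_add_right (fun α => ‖χ α (Function.update o i x)‖ ^ 2) (Pi.single x 1)
    _ = _ := by
      rw [sum_sum_update i (fun o => ∑ α, ‖χ α o‖ ^ 2), nsmul_eq_mul, Finset.sum_comm, ampSq]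
      ring

/-- The part of a family of amplitudes outside of the sector of `k` excitations. -/
def offSector (k : ℕ) (χ : (X → ZMod q) → (ι → X) → ℂ) (α : X → ZMod q) (o : ι → X) : ℂ :=
  if valSum α = k then 0 else χ α o

theorem norm_add_sq_le_of_pos (a b : ℂ) {t : ℝ} (ht : 0 < t) :
    ‖a + b‖ ^ 2 ≤ (1 + t) * ‖a‖ ^ 2 + (1 + 1 / t) * ‖b‖ ^ 2 := by
  have h1 : ‖a + b‖ ^ 2 ≤ (‖a‖ + ‖b‖) ^ 2 := by
    gcongr
    exact norm_add_le a b
  have h2 : 0 ≤ (t * ‖a‖ - ‖b‖) ^ 2 / t := by positivity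
  have h3 : (t * ‖a‖ - ‖b‖) ^ 2 / t = t * ‖a‖ ^ 2 - 2 * ‖a‖ * ‖b‖ + 1 / t * ‖b‖ ^ 2 := by
    field_simp
    ring
  nlinarith

/-- Only the excess `t` of the factor `1 + t` uses the trivial bound `ℓ`. The leading coefficient of
`k` stays 1, which matters because the gain `δ` may be small. -/
theorem sum_ampSq_lower_le_of_offSector [Nonempty X] {k : ℕ} (hk : k + 1 < q)
    (χ : (X → ZMod q) → (ι → X) → ℂ) {t : ℝ} (ht : 0 < t) :
    ∑ i, ampSq (lower χ i) ≤ (Fintype.card X : ℝ) ^ 2 *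
      ((k + (k + 1) * Fintype.card ι / Fintype.card X + t * Fintype.card ι) * ampSq χ +
        (1 + 1 / t) * Fintype.card ι * ampSq (offSector k χ)) := by
  set g : (X → ZMod q) → (ι → X) → ℂ := fun α o => if valSum α = k then χ α o else 0 with hg
  have hsplit : χ = g + offSector k χ := by
    ext α o
    simp only [Pi.add_apply, hg, offSector]
    split_ifs <;> simp
  have hgχ : ampSq g ≤ ampSq χ := by
    refine Finset.sum_le_sum fun α _ => Finset.sum_le_sum fun o _ => ?_
    rw [hg]
    dsimp only
    split_ifs
    · exact le_rfl
    · simp only [norm_zero, ne_eq, OfNat.ofNat_ne_zero, not_false_eq_true, zero_pow]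
      positivity
  have h1 : ∀ i, ampSq (lower χ i) ≤
      (1 + t) * ampSq (lower g i) + (1 + 1 / t) * ampSq (lower (offSector k χ) i) := by
    intro i
    conv_lhs => rw [hsplit]
    rw [ampSq, ampSq, ampSq, Finset.mul_sum, Finset.mul_sum, ← Finset.sum_add_distrib]
    refine Finset.sum_le_sum fun β _ => ?_
    rw [Finset.mul_sum, Finset.mul_sum, ← Finset.sum_add_distrib]
    refine Finset.sum_le_sum fun o _ => ?_
    rw [lower_add]
    exact norm_add_sq_le_of_pos _ _ ht
  have h2 : ∑ i, ampSq (lower g i) ≤ (Fintype.card X : ℝ) ^ 2 *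
      (k + (k + 1) * Fintype.card ι / Fintype.card X) * ampSq χ := by
    refine (sum_ampSq_lower_le k hk g ?_).trans
      (mul_le_mul_of_nonneg_left hgχ (by positivity))
    intro α o h
    by_contra h'
    exact h (if_neg h')
  have h3 : ∑ i, ampSq (lower g i) ≤
      Fintype.card ι * ((Fintype.card X : ℝ) ^ 2 * ampSq χ) := by
    calc _ ≤ ∑ _i : ι, (Fintype.card X : ℝ) ^ 2 * ampSq χ :=
          Finset.sum_le_sum fun i _ => (ampSq_lower_le g i).trans
            (mul_le_mul_of_nonneg_left hgχ (by positivity))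
      _ = _ := by simp
  have h4 : ∑ i, ampSq (lower (offSector k χ) i) ≤
      Fintype.card ι * ((Fintype.card X : ℝ) ^ 2 * ampSq (offSector k χ)) := by
    calc _ ≤ ∑ _i : ι, (Fintype.card X : ℝ) ^ 2 * ampSq (offSector k χ) :=
          Finset.sum_le_sum fun i _ => ampSq_lower_le _ i
      _ = _ := by simp
  have h5 : ∑ i, ampSq (lower χ i) ≤ ∑ i, ampSq (lower g i) + t * ∑ i, ampSq (lower g i) +
      (1 + 1 / t) * ∑ i, ampSq (lower (offSector k χ) i) := by
    refine (Finset.sum_le_sum fun i _ => h1 i).trans (le_of_eq ?_)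
    rw [Finset.sum_add_distrib, ← Finset.mul_sum, ← Finset.mul_sum]
    ring
  have h6 := mul_le_mul_of_nonneg_left h3 ht.le
  have h7 := mul_le_mul_of_nonneg_left h4 (show 0 ≤ 1 + 1 / t by positivity)
  linarith

/-- Averaged over all phases, the number of registers in the state `phaseState θ` is given by the
lowering operators on the Fourier coefficients. -/
theorem sum_overlap_phaseState (F : (X → ZMod q) → (ι → X) → ℂ) (i : ι) :
    ∑ θ, ∑ o, ‖∑ x, conj (phaseState θ x) * F θ (Function.update o i x)‖ ^ 2 =
      (Fintype.card X : ℝ)⁻¹ * (Fintype.card (X → ZMod q) *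
        ampSq (lower (fun α o => phaseCoeff (fun θ => F θ o) α) i)) := by
  set χ : (X → ZMod q) → (ι → X) → ℂ := fun α o => phaseCoeff (fun θ => F θ o) α with hχ
  have h1 : ∀ θ o, ∑ x, conj (phaseState θ x) * F θ (Function.update o i x) =
      ((√(Fintype.card X : ℝ))⁻¹ : ℝ) * ∑ β, phaseChar β θ * lower χ i β o := by
    intro θ o
    have h2 : ∀ x, conj (phaseState θ x) * F θ (Function.update o i x) =
        ((√(Fintype.card X : ℝ))⁻¹ : ℝ) * ∑ β, phaseChar β θ *
          χ (β + Pi.single x 1) (Function.update o i x) := by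
      intro x
      rw [phaseState, map_mul, Complex.conj_ofReal, mul_assoc]
      congr 1
      rw [← sum_phaseChar_mul_phaseCoeff (fun θ => F θ (Function.update o i x)) θ,
        Finset.mul_sum, ← Equiv.sum_comp (Equiv.addRight (Pi.single x (1 : ZMod q)))]
      refine Finset.sum_congr rfl fun β _ => ?_
      rw [Equiv.coe_addRight, phaseChar_add_left, phaseChar_single]
      have := conj_stdAddChar_mul_self (θ x)
      linear_combination (phaseChar β θ *
        χ (β + Pi.single x 1) (Function.update o i x)) * this
    simp_rw [h2]
    rw [← Finset.mul_sum, Finset.sum_comm]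
    congr 1
    refine Finset.sum_congr rfl fun β _ => ?_
    rw [lower, Finset.mul_sum]
  simp_rw [h1, norm_mul, mul_pow, ← Finset.mul_sum]
  rw [Complex.norm_real, Real.norm_eq_abs, sq_abs, inv_pow, Real.sq_sqrt (Nat.cast_nonneg _)]
  congr 1
  rw [Finset.sum_comm]
  simp_rw [sum_normSq_synthesis]
  rw [← Finset.mul_sum, ampSq, Finset.sum_comm]

theorem ampSq_phaseCoeff (F : (X → ZMod q) → (ι → X) → ℂ) :
    Fintype.card (X → ZMod q) * ampSq (fun α o => phaseCoeff (fun θ => F θ o) α) =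
      ∑ θ, ∑ o, ‖F θ o‖ ^ 2 := by
  rw [ampSq, Finset.sum_comm, Finset.mul_sum]
  simp_rw [sum_normSq_phaseCoeff]
  rw [Finset.sum_comm]

end copies

/-! ### Indices allowed by the global phase -/

section sectors

variable {X : Type*} [Fintype X] {q : ℕ} [NeZero q]

/-- Adding 1 to all phases multiplies `F` by `ω^k` and the character at `α` by `ω^(∑ α)`; a nonzero
coefficient forces the two to agree. -/
theorem sum_eq_of_phaseCoeff_ne_zero (F : (X → ZMod q) → ℂ) [DecidableEq X] (k : ℕ)
    (hF : ∀ θ, F (θ + fun _ => 1) = ZMod.stdAddChar (1 : ZMod q) ^ k * F θ) {α : X → ZMod q}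
    (h : phaseCoeff F α ≠ 0) : ∑ x, α x = k := by
  have hk : (ZMod.stdAddChar (1 : ZMod q) : ℂ) ^ k = ZMod.stdAddChar (k : ZMod q) := by
    rw [← AddChar.map_nsmul_eq_pow]
    simp
  have h1 : phaseCoeff F α = ZMod.stdAddChar ((k : ZMod q) - ∑ x, α x) * phaseCoeff F α := by
    conv_lhs => rw [phaseCoeff]
    rw [← Equiv.sum_comp (Equiv.addRight (fun _ : X => (1 : ZMod q)))]
    simp_rw [Equiv.coe_addRight, hF, phaseChar_add_right]
    rw [phaseCoeff, mul_left_comm]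
    congr 1
    rw [Finset.mul_sum]
    refine Finset.sum_congr rfl fun θ _ => ?_
    have h2 : conj (phaseChar α (fun _ => 1)) = ZMod.stdAddChar (-∑ x, α x) := by
      rw [phaseChar, stdAddChar_conj]
      simp
    rw [hk, map_mul, h2, sub_eq_add_neg, AddChar.map_add_eq_mul]
    ring
  have h2 : (ZMod.stdAddChar ((k : ZMod q) - ∑ x, α x) : ℂ) = 1 := by
    have := mul_right_cancel₀ h (h1.symm.trans (one_mul _).symm)
    exact this
  rw [← AddChar.map_zero_eq_one (ZMod.stdAddChar (N := q))] at h2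
  exact (sub_eq_zero.1 (ZMod.injective_stdAddChar h2)).symm

/-- If `absSum α ≤ k`, the sum of signed representatives lies in `[-k, k]` and is `k` modulo `4k`,
so it equals `k`. Equality in the triangle inequality makes all of them nonnegative, and they are
then the standard ones. -/
theorem valSum_eq_or_lt_absSum {k : ℕ} (hq : q = 4 * k) {α : X → ZMod q}
    (h : ∑ x, α x = k) : (valSum α = k ∧ absSum α = k) ∨ k < absSum α := by
  by_cases hlt : k < absSum α
  · exact Or.inr hlt
  left
  have hk : 0 < k := by
    have := NeZero.ne q
    omega
  set S : ℤ := ∑ x, (α x).valMinAbs with hS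
  have habs : ∑ x, |(α x).valMinAbs| = (absSum α : ℤ) := by
    simp [absSum]
  have hle : |S| ≤ (absSum α : ℤ) := habs ▸ Finset.abs_sum_le_sum_abs _ _
  have hmod : ((S - k : ℤ) : ZMod q) = 0 := by
    rw [hS]
    push_cast
    simp [h]
  rw [ZMod.intCast_zmod_eq_zero_iff_dvd] at hmod
  have hSk : S = k := by
    obtain ⟨c, hc⟩ := hmod
    have h1 := abs_le.1 hle
    have hc0 : c = 0 := by
      have h2 : -(2 * k : ℤ) ≤ (q : ℤ) * c := by rw [← hc]; omega
      have h3 : (q : ℤ) * c ≤ 0 := by rw [← hc]; omega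
      subst hq
      push_cast at h2 h3
      have hk' : (0 : ℤ) < k := by exact_mod_cast hk
      have h4 : c ≤ 0 := by
        by_contra h5
        nlinarith
      have h6 : -1 < c := by
        by_contra h5
        nlinarith
      omega
    rw [hc0] at hc
    omega
  have habsk : absSum α = k := by
    have h1 := le_abs_self S
    omega
  have hnn : ∀ x, 0 ≤ (α x).valMinAbs := by
    have h1 : ∑ x, (|(α x).valMinAbs| - (α x).valMinAbs) = 0 := by
      rw [Finset.sum_sub_distrib, habs, ← hS, hSk, habsk]
      simp
    intro x
    have h2 := (Finset.sum_eq_zero_iff_of_nonneg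
      (fun x _ => sub_nonneg.2 (le_abs_self (α x).valMinAbs))).1 h1 x (Finset.mem_univ x)
    have h3 := abs_nonneg (α x).valMinAbs
    omega
  refine ⟨?_, habsk⟩
  rw [← habsk, valSum, absSum]
  refine Finset.sum_congr rfl fun x _ => ?_
  rw [ZMod.valMinAbs_natAbs_eq_min]
  have := (ZMod.valMinAbs_nonneg_iff (α x)).1 (hnn x)
  omega

end sectors

/-! ### The workspace of an algorithm -/

section workspace

variable {n ℓ m : ℕ} {q : ℕ} [NeZero q]

/-- The workspace as the output registers and the rest. -/
def workEquivOut : Work n ℓ m ≃ (Bool × Reg n × (Fin m → Bool)) × (Fin ℓ → Reg n) where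
  toFun s := ((s.ctrl, s.query, s.anc), s.out)
  invFun p := ⟨p.2, p.1.1, p.1.2.1, p.1.2.2⟩
  left_inv _ := rfl
  right_inv _ := rfl

/-- The workspace as the query register and the rest. -/
def workEquivQuery : Work n ℓ m ≃ ((Fin ℓ → Reg n) × Bool × (Fin m → Bool)) × Reg n where
  toFun s := ((s.out, s.ctrl, s.anc), s.query)
  invFun p := ⟨p.1.1, p.1.2.1, p.2, p.1.2.2⟩
  left_inv _ := rfl
  right_inv _ := rfl

theorem sum_work_out {M : Type*} [AddCommMonoid M] (f : Work n ℓ m → M) :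
    ∑ s, f s = ∑ r : Bool × Reg n × (Fin m → Bool), ∑ o : Fin ℓ → Reg n,
      f (workEquivOut.symm (r, o)) := by
  rw [← Fintype.sum_prod_type' (f := fun r o => f (workEquivOut.symm (r, o))),
    ← Equiv.sum_comp workEquivOut.symm]

theorem sum_work_query {M : Type*} [AddCommMonoid M] (f : Work n ℓ m → M) :
    ∑ s, f s = ∑ r : (Fin ℓ → Reg n) × Bool × (Fin m → Bool), ∑ x : Reg n,
      f (workEquivQuery.symm (r, x)) := by
  rw [← Fintype.sum_prod_type' (f := fun r o => f (workEquivQuery.symm (r, o))),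
    ← Equiv.sum_comp workEquivQuery.symm]

theorem applyQuery_of_ctrl (ψ : EuclideanSpace ℂ (Reg n)) (Φ : WorkVec n ℓ m)
    (r : (Fin ℓ → Reg n) × Bool × (Fin m → Bool)) (hr : r.2.1 = true) (x : Reg n) :
    applyQuery ψ Φ (workEquivQuery.symm (r, x)) =
      reflectAlong ψ.ofLp (fun y => Φ (workEquivQuery.symm (r, y))) x := by
  obtain ⟨o, b, a⟩ := r
  obtain rfl : b = true := hr
  simp only [applyQuery, workEquivQuery, Equiv.coe_fn_symm_mk, if_true, oracle, reflectAlong,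
    Matrix.sub_apply, Matrix.smul_apply, Matrix.vecMulVec_apply, Pi.star_apply, smul_eq_mul,
    sub_mul, Finset.sum_sub_distrib, Matrix.one_apply, ite_mul, one_mul, zero_mul,
    Finset.sum_ite_eq, Finset.mem_univ]
  congr 1
  rw [Finset.mul_sum]
  refine Finset.sum_congr rfl fun y _ => ?_
  rw [Complex.star_def]
  ring

theorem applyQuery_of_not_ctrl (ψ : EuclideanSpace ℂ (Reg n)) (Φ : WorkVec n ℓ m)
    (r : (Fin ℓ → Reg n) × Bool × (Fin m → Bool)) (hr : r.2.1 = false) (x : Reg n) :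
    applyQuery ψ Φ (workEquivQuery.symm (r, x)) = Φ (workEquivQuery.symm (r, x)) := by
  obtain ⟨o, b, a⟩ := r
  obtain rfl : b = false := hr
  simp [applyQuery, workEquivQuery]

theorem sum_conj_mulVec {W : Type*} [Fintype W] [DecidableEq W] (V : Matrix.unitaryGroup W ℂ)
    (u v : W → ℂ) :
    ∑ s, conj ((V : Matrix W W ℂ).mulVec u s) * (V : Matrix W W ℂ).mulVec v s =
      ∑ s, conj (u s) * v s := by
  have h : star ((V : Matrix W W ℂ).mulVec u) ⬝ᵥ (V : Matrix W W ℂ).mulVec v = star u ⬝ᵥ v := by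
    rw [Matrix.star_mulVec, Matrix.dotProduct_mulVec, Matrix.vecMul_vecMul,
      ← Matrix.star_eq_conjTranspose, Matrix.UnitaryGroup.star_mul_self, Matrix.vecMul_one]
  simpa [dotProduct] using h

theorem sum_conj_reflectAlong {X : Type*} [Fintype X] [DecidableEq X] (ψ u : X → ℂ)
    (hψ : ∑ x, ‖ψ x‖ ^ 2 = 1) :
    ∑ x, conj (reflectAlong ψ u x) * reflectAlong ψ u x = ∑ x, conj (u x) * u x := by
  have h := inner_reflectAlong_sub ψ ψ u u 1
  have h1 : ∑ x, conj (ψ x) * ψ x = 1 := by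
    simp_rw [Complex.conj_mul']
    exact_mod_cast hψ
  rw [h1] at h
  simp only [map_one, one_mul, sub_self, zero_mul, Finset.sum_const_zero, map_zero, mul_zero,
    add_zero] at h
  exact sub_eq_zero.1 h

theorem sum_conj_applyQuery (ψ : EuclideanSpace ℂ (Reg n)) (hψ : ∑ x, ‖ψ.ofLp x‖ ^ 2 = 1)
    (Φ : WorkVec n ℓ m) :
    ∑ s, conj (applyQuery ψ Φ s) * applyQuery ψ Φ s = ∑ s, conj (Φ s) * Φ s := by
  rw [sum_work_query, sum_work_query (fun s => conj (Φ s) * Φ s)]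
  refine Finset.sum_congr rfl fun r _ => ?_
  cases hr : r.2.1
  · simp_rw [applyQuery_of_not_ctrl ψ Φ r hr]
  · simp_rw [applyQuery_of_ctrl ψ Φ r hr]
    exact sum_conj_reflectAlong _ (fun y => Φ (workEquivQuery.symm (r, y))) hψ

theorem sum_conj_initialState (k : ℕ) (hk : k ≤ ℓ) (ψ φ : EuclideanSpace ℂ (Reg n)) :
    ∑ s, conj (initialState ℓ m k ψ s) * initialState ℓ m k φ s =
      (∑ x, conj (ψ.ofLp x) * φ.ofLp x) ^ k := by
  rw [sum_work_out]
  have h1 : ∀ (r : Bool × Reg n × (Fin m → Bool)) (o : Fin ℓ → Reg n),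
      conj (initialState ℓ m k ψ (workEquivOut.symm (r, o))) *
        initialState ℓ m k φ (workEquivOut.symm (r, o)) =
      (if r = (false, (fun _ => false), fun _ => false) then 1 else 0) *
        ∏ i : Fin ℓ, (if (i : ℕ) < k then conj (ψ.ofLp (o i)) * φ.ofLp (o i)
          else if o i = fun _ => false then 1 else 0) := by
    rintro ⟨b, y, a⟩ o
    have e : ∀ ψ : EuclideanSpace ℂ (Reg n),
        initialState ℓ m k ψ (workEquivOut.symm ((b, y, a), o)) =
        (∏ i : Fin ℓ, if (i : ℕ) < k then ψ.ofLp (o i) else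
          if o i = fun _ => false then 1 else 0) *
        (if b = false ∧ (y = fun _ => false) ∧ (a = fun _ => false) then 1 else 0) := fun _ => rfl
    rw [e, e]
    simp only [map_mul, map_prod, Prod.mk.injEq]
    rw [mul_mul_mul_comm, ← Finset.prod_mul_distrib, mul_comm]
    congr 1
    · split_ifs <;> simp
    · refine Finset.prod_congr rfl fun i _ => ?_
      split_ifs <;> simp
  simp_rw [h1, ← Finset.mul_sum]
  rw [← Finset.sum_mul, Finset.sum_ite_eq' Finset.univ, if_pos (Finset.mem_univ _), one_mul,
    ← Fintype.prod_sum (fun (i : Fin ℓ) (y : Reg n) => if (i : ℕ) < k then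
      conj (ψ.ofLp y) * φ.ofLp y else if y = fun _ => false then 1 else 0)]
  have h2 : ∀ i : Fin ℓ, (∑ y : Reg n, if (i : ℕ) < k then conj (ψ.ofLp y) * φ.ofLp y else
      if y = fun _ => false then 1 else 0) =
      if (i : ℕ) < k then ∑ x, conj (ψ.ofLp x) * φ.ofLp x else 1 := by
    intro i
    split_ifs
    · rfl
    · simp
  simp_rw [h2]
  rw [Fin.prod_univ_eq_prod_range
    (fun i => if i < k then ∑ x, conj (ψ.ofLp x) * φ.ofLp x else 1) ℓ,
    Finset.prod_ite, Finset.prod_const, Finset.prod_const_one, mul_one]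
  congr 1
  have h3 : (Finset.range ℓ).filter (fun i => i < k) = Finset.range k := by
    ext i
    simp only [Finset.mem_filter, Finset.mem_range]
    omega
  rw [h3, Finset.card_range]

theorem sum_normSq_runState (V : ℕ → Matrix.unitaryGroup (Work n ℓ m) ℂ) (k : ℕ) (hk : k ≤ ℓ)
    (ψ : EuclideanSpace ℂ (Reg n)) (hψ : ∑ x, ‖ψ.ofLp x‖ ^ 2 = 1) (t : ℕ) :
    ∑ s, ‖runState V k ψ t s‖ ^ 2 = 1 := by
  have h1 : ∑ x, conj (ψ.ofLp x) * ψ.ofLp x = 1 := by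
    simp_rw [Complex.conj_mul']
    exact_mod_cast hψ
  have h2 : ∑ s, conj (runState V k ψ t s) * runState V k ψ t s = 1 := by
    induction t with
    | zero => rw [runState, sum_conj_mulVec, sum_conj_initialState k hk, h1, one_pow]
    | succ t ih => rw [runState, sum_conj_mulVec, sum_conj_applyQuery ψ hψ, ih]
  simp_rw [Complex.conj_mul'] at h2
  exact_mod_cast h2

theorem initialState_smul (k : ℕ) (hk : k ≤ ℓ) (z : ℂ) (ψ : EuclideanSpace ℂ (Reg n)) :
    initialState ℓ m k (z • ψ) = z ^ k • initialState ℓ m k ψ := by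
  funext s
  rw [Pi.smul_apply, initialState, initialState, smul_eq_mul, ← mul_assoc]
  congr 1
  have h1 : ∀ i : Fin ℓ, (if (i : ℕ) < k then (z • ψ) (s.out i) else
      if s.out i = fun _ => false then (1 : ℂ) else 0) =
      (if (i : ℕ) < k then z else 1) * (if (i : ℕ) < k then ψ (s.out i) else
      if s.out i = fun _ => false then (1 : ℂ) else 0) := by
    intro i
    split_ifs <;> simp
  simp_rw [h1, Finset.prod_mul_distrib]
  congr 1
  rw [Fin.prod_univ_eq_prod_range (fun i => if i < k then z else 1) ℓ,
    Finset.prod_ite, Finset.prod_const, Finset.prod_const_one, mul_one]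
  congr 1
  have h3 : (Finset.range ℓ).filter (fun i => i < k) = Finset.range k := by
    ext i
    simp only [Finset.mem_filter, Finset.mem_range]
    omega
  rw [h3, Finset.card_range]

theorem applyQuery_smul (z w : ℂ) (hz : z * conj z = 1) (ψ : EuclideanSpace ℂ (Reg n))
    (Φ : WorkVec n ℓ m) : applyQuery (z • ψ) (w • Φ) = w • applyQuery ψ Φ := by
  have h : oracle (z • ψ) = oracle ψ := by
    ext a b
    simp only [oracle, Matrix.sub_apply, Matrix.smul_apply, Matrix.vecMulVec_apply, Pi.star_apply,
      smul_eq_mul, WithLp.ofLp_smul, Pi.smul_apply, star_mul', Complex.star_def]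
    linear_combination (-2 * ψ.ofLp a * conj (ψ.ofLp b)) * hz
  funext s
  rw [Pi.smul_apply, applyQuery, applyQuery, h]
  split_ifs
  · simp only [Pi.smul_apply, smul_eq_mul, Finset.mul_sum]
    refine Finset.sum_congr rfl fun x _ => ?_
    ring
  · rfl

/-- The reflection depends only on the ray of `ψ`, so a global phase enters through the `k` input
copies alone. -/
theorem runState_smul (V : ℕ → Matrix.unitaryGroup (Work n ℓ m) ℂ) (k : ℕ) (hk : k ≤ ℓ)
    (z : ℂ) (hz : z * conj z = 1) (ψ : EuclideanSpace ℂ (Reg n)) (t : ℕ) :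
    runState V k (z • ψ) t = z ^ k • runState V k ψ t := by
  induction t with
  | zero => rw [runState, runState, initialState_smul k hk, Matrix.mulVec_smul]
  | succ t ih => rw [runState, runState, ih, applyQuery_smul z _ hz, Matrix.mulVec_smul]

/-- The fidelity of a reduced state is a squared overlap. -/
theorem fidelity_reducedState (ψ : EuclideanSpace ℂ (Reg n)) (Φ : WorkVec n ℓ m) (i : Fin ℓ) :
    fidelity ψ (reducedState Φ i) = (Fintype.card (Reg n) : ℝ)⁻¹ *
      ∑ r, ∑ o, ‖∑ x, conj (ψ.ofLp x) *
        Φ (workEquivOut.symm (r, Function.update o i x))‖ ^ 2 := by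
  have hN : (Fintype.card (Reg n) : ℂ) ≠ 0 := Nat.cast_ne_zero.2 Fintype.card_ne_zero
  have h1 : star ψ.ofLp ⬝ᵥ (reducedState Φ i).mulVec ψ.ofLp =
      ∑ r, ∑ o : Fin ℓ → Reg n, (conj (ψ.ofLp (o i)) * Φ (workEquivOut.symm (r, o))) *
        conj (∑ x, conj (ψ.ofLp x) * Φ (workEquivOut.symm (r, Function.update o i x))) := by
    simp only [dotProduct, Matrix.mulVec, reducedState, Pi.star_apply]
    have e : ∀ a, star (ψ.ofLp a) * ∑ b, (∑ s : Work n ℓ m,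
        if s.out i = a then Φ s * star (Φ { s with out := Function.update s.out i b }) else 0) *
          ψ.ofLp b = ∑ s : Work n ℓ m, if s.out i = a then (conj (ψ.ofLp a) * Φ s) *
            conj (∑ b, conj (ψ.ofLp b) * Φ { s with out := Function.update s.out i b }) else 0 := by
      intro a
      simp_rw [Finset.sum_mul]
      rw [Finset.sum_comm, Finset.mul_sum]
      refine Finset.sum_congr rfl fun s _ => ?_
      split_ifs
      · rw [map_sum, Finset.mul_sum, Finset.mul_sum]
        refine Finset.sum_congr rfl fun b _ => ?_
        simp only [map_mul, Complex.conj_conj, Complex.star_def]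
        ring
      · simp
    simp_rw [e]
    rw [Finset.sum_comm]
    simp_rw [Finset.sum_ite_eq, Finset.mem_univ, if_true]
    rw [sum_work_out]
    rfl
  have h2 : ∀ r : Bool × Reg n × (Fin m → Bool), ∑ o : Fin ℓ → Reg n,
      (conj (ψ.ofLp (o i)) * Φ (workEquivOut.symm (r, o))) *
        conj (∑ x, conj (ψ.ofLp x) * Φ (workEquivOut.symm (r, Function.update o i x))) =
      (Fintype.card (Reg n) : ℂ)⁻¹ * ∑ o, ((‖∑ x, conj (ψ.ofLp x) *
        Φ (workEquivOut.symm (r, Function.update o i x))‖ : ℝ) : ℂ) ^ 2 := by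
    intro r
    -- The overlap does not depend on `o i`, so a sum over all `o` counts it `N` times; this is the
    -- factor `N⁻¹`.
    rw [eq_inv_mul_iff_mul_eq₀ hN, ← nsmul_eq_mul, ← sum_sum_update i]
    refine Finset.sum_congr rfl fun o _ => ?_
    simp only [Function.update_self, Function.update_idem]
    rw [← Finset.sum_mul, Complex.mul_conj']
  rw [fidelity, h1]
  simp_rw [h2]
  rw [← Finset.mul_sum, ← Complex.ofReal_re ((Fintype.card (Reg n) : ℝ)⁻¹ * _)]
  congr 1
  push_cast
  rfl

end workspace

/-! ### The lower bound -/

section lowerBound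

variable {n ℓ m : ℕ} {q : ℕ} [NeZero q]

/-- `phaseState θ` as a vector of the Hilbert space of an `n`-qubit register. -/
noncomputable def phaseVec (θ : Reg n → ZMod q) : EuclideanSpace ℂ (Reg n) :=
  WithLp.toLp 2 (phaseState θ)

theorem ofLp_phaseVec (θ : Reg n → ZMod q) : (phaseVec θ).ofLp = phaseState θ := rfl

theorem norm_phaseVec (θ : Reg n → ZMod q) : ‖phaseVec θ‖ = 1 := by
  rw [EuclideanSpace.norm_eq]
  simp only [phaseVec]
  rw [sum_norm_phaseState_sq, Real.sqrt_one]

theorem phaseVec_add_const (θ : Reg n → ZMod q) :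
    phaseVec (θ + fun _ => 1) = (ZMod.stdAddChar (1 : ZMod q) : ℂ) • phaseVec θ := by
  ext x
  simp [phaseVec, phaseState_add]

/-- The noise stability of a family of states (up to normalization). -/
noncomputable def stability {W : Type*} [Fintype W] (w : (Reg n → ZMod q) → ℝ)
    (Φ : (Reg n → ZMod q) → W → ℂ) : ℂ :=
  ∑ θ, ∑ ξ, (w ξ : ℂ) * ∑ s, conj (Φ θ s) * Φ (θ + ξ) s

variable {ρ : ℝ} {w : (Reg n → ZMod q) → ℝ}

theorem norm_stability_applyQuery_sub_le (hw : IsPoissonNoise ρ w) (hq : 2 ≤ q)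
    (Φ : (Reg n → ZMod q) → WorkVec n ℓ m) :
    ‖stability w (fun θ => applyQuery (phaseVec θ) (Φ θ)) - stability w Φ‖ ≤
      8 / √(Fintype.card (Reg n)) * ∑ θ, ∑ s, ‖Φ θ s‖ ^ 2 := by
  set A : ((Fin ℓ → Reg n) × Bool × (Fin m → Bool)) → (Reg n → ZMod q) → Reg n → ℂ :=
    fun r θ x => Φ θ (workEquivQuery.symm (r, x)) with hA
  set D : ((Fin ℓ → Reg n) × Bool × (Fin m → Bool)) → (Reg n → ZMod q) → (Reg n → ZMod q) → ℂ :=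
    fun r θ ξ => (∑ x, conj (applyQuery (phaseVec θ) (Φ θ) (workEquivQuery.symm (r, x))) *
      applyQuery (phaseVec (θ + ξ)) (Φ (θ + ξ)) (workEquivQuery.symm (r, x))) -
      ∑ x, conj (A r θ x) * A r (θ + ξ) x with hD
  have h1 : stability w (fun θ => applyQuery (phaseVec θ) (Φ θ)) - stability w Φ =
      ∑ r, ∑ θ, ∑ ξ, (w ξ : ℂ) * D r θ ξ := by
    rw [stability, stability, ← Finset.sum_sub_distrib, Finset.sum_comm]
    refine Finset.sum_congr rfl fun θ _ => ?_
    rw [← Finset.sum_sub_distrib, Finset.sum_comm]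
    refine Finset.sum_congr rfl fun ξ _ => ?_
    rw [← mul_sub, sum_work_query, sum_work_query (fun s => conj (Φ θ s) * Φ (θ + ξ) s),
      ← Finset.sum_sub_distrib, Finset.mul_sum]
  have h2 : ∀ r, ‖∑ θ, ∑ ξ, (w ξ : ℂ) * D r θ ξ‖ ≤
      8 / √(Fintype.card (Reg n)) * ∑ θ, ∑ x, ‖A r θ x‖ ^ 2 := by
    intro r
    cases hr : r.2.1
    · have h3 : ∀ θ ξ, D r θ ξ = 0 := by
        intro θ ξ
        simp only [hD, hA]
        simp_rw [applyQuery_of_not_ctrl _ _ r hr]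
        exact sub_self _
      simp_rw [h3]
      simp only [mul_zero, Finset.sum_const_zero, norm_zero]
      positivity
    · have h3 := hw.query_step hq (A r)
      refine le_trans (le_of_eq ?_) h3
      congr 1
      refine Finset.sum_congr rfl fun θ _ => Finset.sum_congr rfl fun ξ _ => ?_
      simp only [hD]
      simp_rw [applyQuery_of_ctrl _ _ r hr]
      rfl
  rw [h1]
  calc _ ≤ ∑ r, 8 / √(Fintype.card (Reg n)) * ∑ θ, ∑ x, ‖A r θ x‖ ^ 2 :=
        (norm_sum_le _ _).trans (Finset.sum_le_sum fun r _ => h2 r)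
    _ = _ := by
      rw [← Finset.mul_sum, Finset.sum_comm]
      congr 1
      refine Finset.sum_congr rfl fun θ _ => ?_
      rw [sum_work_query]

theorem stability_mulVec {W : Type*} [Fintype W] [DecidableEq W] (V : Matrix.unitaryGroup W ℂ)
    (Φ : (Reg n → ZMod q) → W → ℂ) :
    stability w (fun θ => (V : Matrix W W ℂ).mulVec (Φ θ)) = stability w Φ := by
  simp_rw [stability, sum_conj_mulVec]

theorem sum_normSq_runState_phaseVec (V : ℕ → Matrix.unitaryGroup (Work n ℓ m) ℂ) (k : ℕ)
    (hk : k ≤ ℓ) (θ : Reg n → ZMod q) (t : ℕ) : ∑ s, ‖runState V k (phaseVec θ) t s‖ ^ 2 = 1 :=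
  sum_normSq_runState V k hk (phaseVec θ) (by rw [ofLp_phaseVec, sum_norm_phaseState_sq]) t

theorem norm_stability_runState_sub_le (hw : IsPoissonNoise ρ w) (hq : 2 ≤ q)
    (V : ℕ → Matrix.unitaryGroup (Work n ℓ m) ℂ) (k : ℕ) (hk : k ≤ ℓ) (T : ℕ) :
    ‖stability w (fun θ => runState V k (phaseVec θ) T) -
      stability w (fun θ => initialState ℓ m k (phaseVec θ))‖ ≤
      T * (8 / √(Fintype.card (Reg n)) * Fintype.card (Reg n → ZMod q)) := by
  induction T with
  | zero =>
    simp only [runState]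
    rw [stability_mulVec]
    simp
  | succ T ih =>
    have h := norm_stability_applyQuery_sub_le hw hq (fun θ => runState V k (phaseVec θ) T)
    simp_rw [sum_normSq_runState_phaseVec V k hk] at h
    simp only [runState]
    rw [stability_mulVec]
    refine (norm_sub_le_norm_sub_add_norm_sub _
      (stability w (fun θ => runState V k (phaseVec θ) T)) _).trans ?_
    push_cast
    simp only [Finset.sum_const, Finset.card_univ, nsmul_eq_mul, mul_one] at h
    linarith

/-- The `k`-th power of the overlap expands into characters indexed by sums of `k` unit vectors,
which have length at most `k`. -/
theorem le_re_stability_initialState (hw : IsPoissonNoise ρ w) (hq : 2 ≤ q) (h0 : 0 ≤ ρ)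
    (h1 : ρ ≤ 1) (k : ℕ) (hk : k ≤ ℓ) :
    Fintype.card (Reg n → ZMod q) * ρ ^ k ≤
      (stability w (fun θ => initialState ℓ m k (phaseVec θ))).re := by
  have hN : (Fintype.card (Reg n) : ℝ) ≠ 0 := Nat.cast_ne_zero.2 Fintype.card_ne_zero
  have e1 : ∀ θ ξ : Reg n → ZMod q, (w ξ : ℂ) * ∑ s, conj (initialState ℓ m k (phaseVec θ) s) *
      initialState ℓ m k (phaseVec (θ + ξ)) s =
      ∑ p : Fin k → Reg n, ((Fintype.card (Reg n) : ℂ)⁻¹) ^ k *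
        (w ξ * phaseChar (∑ a, Pi.single (p a) 1) ξ) := by
    intro θ ξ
    rw [sum_conj_initialState k hk]
    simp only [phaseVec]
    simp_rw [conj_phaseState_mul_add]
    rw [← Finset.sum_mul, mul_pow, Fintype.sum_pow, Finset.sum_mul, Finset.mul_sum]
    refine Finset.sum_congr rfl fun p _ => ?_
    have e2 : phaseChar (∑ a, Pi.single (p a) 1) ξ = ∏ a, ZMod.stdAddChar (ξ (p a)) := by
      have e3 : ∀ S : Finset (Fin k), phaseChar (∑ a ∈ S, Pi.single (p a) 1) ξ =
          ∏ a ∈ S, ZMod.stdAddChar (ξ (p a)) := by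
        intro S
        induction S using Finset.induction_on with
        | empty => simp
        | insert a S ha ih =>
          rw [Finset.sum_insert ha, Finset.prod_insert ha, phaseChar_add_left, phaseChar_single, ih]
      exact e3 Finset.univ
    rw [e2]
    ring
  have habs : ∀ p : Fin k → Reg n,
      absSum (∑ a, Pi.single (p a) 1 : Reg n → ZMod q) ≤ k := by
    intro p
    have e3 : ∀ S : Finset (Fin k),
        absSum (∑ a ∈ S, Pi.single (p a) 1 : Reg n → ZMod q) ≤ S.card := by
      intro S
      induction S using Finset.induction_on with
      | empty => simp [absSum]
      | insert a S ha ih =>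
        rw [Finset.sum_insert ha, Finset.card_insert_of_notMem ha]
        have := absSum_add_le (Pi.single (p a) 1 : Reg n → ZMod q) (∑ a ∈ S, Pi.single (p a) 1)
        rw [absSum_single hq] at this
        omega
    simpa using e3 Finset.univ
  have e4 : stability w (fun θ => initialState ℓ m k (phaseVec θ)) =
      ((Fintype.card (Reg n → ZMod q) * ∑ p : Fin k → Reg n,
        ((Fintype.card (Reg n) : ℝ)⁻¹) ^ k *
          ρ ^ absSum (∑ a, Pi.single (p a) 1 : Reg n → ZMod q) : ℝ) : ℂ) := by
    rw [stability]
    simp_rw [e1]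
    rw [Finset.sum_const, Finset.card_univ, nsmul_eq_mul, Finset.sum_comm]
    simp_rw [← Finset.mul_sum, hw.sum_char]
    push_cast
    rfl
  rw [e4, Complex.ofReal_re]
  refine mul_le_mul_of_nonneg_left ?_ (Nat.cast_nonneg _)
  calc ρ ^ k = ∑ _p : Fin k → Reg n, ((Fintype.card (Reg n) : ℝ)⁻¹) ^ k * ρ ^ k := by
        rw [Finset.sum_const, Finset.card_univ, nsmul_eq_mul, Fintype.card_fun, Fintype.card_fin,
          Nat.cast_pow, ← mul_assoc, ← mul_pow, mul_inv_cancel₀ hN, one_pow, one_mul]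
    _ ≤ _ := by
      refine Finset.sum_le_sum fun p _ => mul_le_mul_of_nonneg_left ?_ (by positivity)
      exact pow_le_pow_of_le_one h0 h1 (habs p)

/-- The amplitudes of a family of states, for a fixed state of the rest of the workspace. -/
noncomputable def outAmp (Φ : (Reg n → ZMod q) → WorkVec n ℓ m)
    (r : Bool × Reg n × (Fin m → Bool)) (α : Reg n → ZMod q) (o : Fin ℓ → Reg n) : ℂ :=
  phaseCoeff (fun θ => Φ θ (workEquivOut.symm (r, o))) α

theorem stability_eq (hw : IsPoissonNoise ρ w) (Φ : (Reg n → ZMod q) → WorkVec n ℓ m) :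
    stability w Φ = ((Fintype.card (Reg n → ZMod q) *
      ∑ r, ∑ α, ∑ o, ρ ^ absSum α * ‖outAmp Φ r α o‖ ^ 2 : ℝ) : ℂ) := by
  have h1 : stability w Φ =
      ∑ s, ∑ θ, ∑ ξ, (w ξ : ℂ) * (conj (Φ θ s) * Φ (θ + ξ) s) := by
    rw [stability, Finset.sum_comm (γ := Work n ℓ m)]
    refine Finset.sum_congr rfl fun θ _ => ?_
    rw [Finset.sum_comm]
    refine Finset.sum_congr rfl fun ξ _ => ?_
    rw [Finset.mul_sum]
  rw [h1]
  simp_rw [fun s => hw.stability (fun θ => Φ θ s)]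
  rw [← Complex.ofReal_sum, ← Finset.mul_sum, sum_work_out]
  congr 2
  refine Finset.sum_congr rfl fun r _ => ?_
  rw [Finset.sum_comm]
  rfl

theorem sum_ampSq_outAmp (Φ : (Reg n → ZMod q) → WorkVec n ℓ m)
    (hΦ : ∀ θ, ∑ s, ‖Φ θ s‖ ^ 2 = 1) : ∑ r, ampSq (outAmp Φ r) = 1 := by
  have hG : (Fintype.card (Reg n → ZMod q) : ℝ) ≠ 0 := Nat.cast_ne_zero.2 Fintype.card_ne_zero
  have h1 : Fintype.card (Reg n → ZMod q) * ∑ r, ampSq (outAmp Φ r) =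
      Fintype.card (Reg n → ZMod q) * 1 := by
    rw [Finset.mul_sum]
    have h2 : ∀ r, Fintype.card (Reg n → ZMod q) * ampSq (outAmp Φ r) =
        ∑ θ, ∑ o, ‖Φ θ (workEquivOut.symm (r, o))‖ ^ 2 := fun r =>
      ampSq_phaseCoeff (fun θ o => Φ θ (workEquivOut.symm (r, o)))
    simp_rw [h2]
    rw [Finset.sum_comm]
    have h3 : ∀ θ, ∑ r, ∑ o, ‖Φ θ (workEquivOut.symm (r, o))‖ ^ 2 = 1 := by
      intro θ
      rw [← hΦ θ, sum_work_out]
    simp_rw [h3]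
    simp
  exact mul_left_cancel₀ hG h1

theorem outAmp_runState_sum_eq (V : ℕ → Matrix.unitaryGroup (Work n ℓ m) ℂ) (k : ℕ) (hk : k ≤ ℓ)
    (T : ℕ) (r : Bool × Reg n × (Fin m → Bool)) {α : Reg n → ZMod q} {o : Fin ℓ → Reg n}
    (h : outAmp (fun θ => runState V k (phaseVec θ) T) r α o ≠ 0) : ∑ x, α x = k := by
  refine sum_eq_of_phaseCoeff_ne_zero _ k (fun θ => ?_) h
  have hz : (ZMod.stdAddChar (1 : ZMod q) : ℂ) * conj (ZMod.stdAddChar (1 : ZMod q)) = 1 := by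
    rw [mul_comm, conj_stdAddChar_mul_self]
  beta_reduce
  rw [phaseVec_add_const, runState_smul V k hk _ hz]
  rfl

/-- After `T` queries, little weight has left the sector of `k` excitations. -/
theorem offSector_weight_le (hw : IsPoissonNoise ρ w) {k : ℕ} (hq : q = 4 * k) (h0 : 0 ≤ ρ)
    (h1 : ρ ≤ 1) (hk : k ≤ ℓ) (V : ℕ → Matrix.unitaryGroup (Work n ℓ m) ℂ) (T : ℕ) :
    ρ ^ k * (1 - ρ) *
      ∑ r, ampSq (offSector k (outAmp (fun θ : Reg n → ZMod q => runState V k (phaseVec θ) T) r)) ≤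
      T * (8 / √(Fintype.card (Reg n))) := by
  have hq2 : 2 ≤ q := by
    have := NeZero.ne q
    omega
  have hG : (0 : ℝ) < Fintype.card (Reg n → ZMod q) := Nat.cast_pos.2 Fintype.card_pos
  set χ := outAmp (fun θ : Reg n → ZMod q => runState V k (phaseVec θ) T) with hχ
  have hs := stability_eq hw (fun θ : Reg n → ZMod q => runState V k (phaseVec θ) T)
  rw [← hχ] at hs
  have hre : (stability w (fun θ => runState V k (phaseVec θ) T)).re =
      Fintype.card (Reg n → ZMod q) * ∑ r, ∑ α, ∑ o, ρ ^ absSum α * ‖χ r α o‖ ^ 2 := by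
    rw [hs, Complex.ofReal_re]
  have hdiff := (Complex.abs_re_le_norm _).trans
    (norm_stability_runState_sub_le hw hq2 V k hk T)
  rw [Complex.sub_re] at hdiff
  have hini := le_re_stability_initialState (ℓ := ℓ) (m := m) hw hq2 h0 h1 k hk
  have hnorm := sum_ampSq_outAmp (fun θ : Reg n → ZMod q => runState V k (phaseVec θ) T)
    (fun θ => sum_normSq_runState_phaseVec V k hk θ T)
  rw [← hχ] at hnorm
  have hpt : ρ ^ k * (1 - ρ) * ∑ r, ampSq (offSector k (χ r)) ≤
      ρ ^ k * ∑ r, ampSq (χ r) - ∑ r, ∑ α, ∑ o, ρ ^ absSum α * ‖χ r α o‖ ^ 2 := by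
    rw [Finset.mul_sum, Finset.mul_sum, ← Finset.sum_sub_distrib]
    refine Finset.sum_le_sum fun r _ => ?_
    rw [ampSq, ampSq, Finset.mul_sum, Finset.mul_sum, ← Finset.sum_sub_distrib]
    refine Finset.sum_le_sum fun α _ => ?_
    rw [Finset.mul_sum, Finset.mul_sum, ← Finset.sum_sub_distrib]
    refine Finset.sum_le_sum fun o _ => ?_
    rw [offSector, ← sub_mul]
    by_cases hz : χ r α o = 0
    · simp [hz]
    have hsum := outAmp_runState_sum_eq V k hk T r hz
    rcases valSum_eq_or_lt_absSum hq hsum with h | h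
    · rw [if_pos h.1, h.2]
      simp
    -- Lengths are integers, so leaving the sector costs at least a full factor `ρ`, that is, a gap
    -- of `ρ ^ k * (1 - ρ)`.
    · have h2 : ρ ^ absSum α ≤ ρ ^ (k + 1) := pow_le_pow_of_le_one h0 h1 h
      have h3 : ρ ^ k * (1 - ρ) ≤ ρ ^ k - ρ ^ absSum α := by
        rw [pow_succ] at h2
        linarith
      split_ifs
      · have h4 : 0 ≤ ρ ^ k * (1 - ρ) := mul_nonneg (pow_nonneg h0 k) (by linarith)
        simp only [norm_zero, ne_eq, OfNat.ofNat_ne_zero, not_false_eq_true, zero_pow, mul_zero]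
        exact mul_nonneg (h4.trans h3) (sq_nonneg _)
      · exact mul_le_mul_of_nonneg_right h3 (sq_nonneg _)
  rw [hnorm, mul_one] at hpt
  refine hpt.trans ?_
  refine le_of_mul_le_mul_left ?_ hG
  have h5 := neg_le_of_abs_le hdiff
  rw [hre] at h5
  linarith

/-- One factor `N⁻¹` comes from normalizing the phase state, the other from the dummy coordinate in
`fidelity_reducedState`. -/
theorem sum_fidelity_eq (Φ : (Reg n → ZMod q) → WorkVec n ℓ m) :
    ∑ θ, ∑ i, fidelity (phaseVec θ) (reducedState (Φ θ) i) =
      Fintype.card (Reg n → ZMod q) * (((Fintype.card (Reg n) : ℝ) ^ 2)⁻¹ *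
        ∑ r, ∑ i, ampSq (lower (outAmp Φ r) i)) := by
  simp_rw [fidelity_reducedState]
  rw [Finset.sum_comm, Finset.sum_comm (f := fun r i => ampSq (lower (outAmp Φ r) i)),
    Finset.mul_sum, Finset.mul_sum]
  refine Finset.sum_congr rfl fun i _ => ?_
  rw [← Finset.mul_sum, Finset.sum_comm]
  have h1 : ∀ r, ∑ θ, ∑ o, ‖∑ x, conj ((phaseVec θ).ofLp x) *
      Φ θ (workEquivOut.symm (r, Function.update o i x))‖ ^ 2 =
      (Fintype.card (Reg n) : ℝ)⁻¹ * (Fintype.card (Reg n → ZMod q) *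
        ampSq (lower (outAmp Φ r) i)) := fun r =>
    sum_overlap_phaseState (fun θ o => Φ θ (workEquivOut.symm (r, o))) i
  simp_rw [h1, ← Finset.mul_sum]
  rw [pow_two, mul_inv]
  ring

theorem excess_bounds {k T : ℕ} (hk1 : 1 ≤ k) (hkl : k < ℓ) {δ : ℝ}
    (V : ℕ → Matrix.unitaryGroup (Work n ℓ m) ℂ)
    (H : ∀ ψ : EuclideanSpace ℂ (Reg n), ‖ψ‖ = 1 →
      (k : ℝ) + δ ≤ ∑ i : Fin ℓ, fidelity ψ (reducedState (runState V k ψ T) i)) :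
    k + δ ≤ ℓ ∧ ∀ t : ℝ, 0 < t →
      δ ≤ (k + 1) * ℓ / 2 ^ n + t * ℓ + (1 + 1 / t) * ℓ * (32 * k * T / √((2 : ℝ) ^ n)) := by
  have hq : NeZero (4 * k) := ⟨by omega⟩
  have hk0 : (0 : ℝ) < k := Nat.cast_pos.2 hk1
  have hk1' : (1 : ℝ) ≤ k := by exact_mod_cast hk1
  -- Bernoulli gives `ρ ^ k ≥ 1/2` while `1 - ρ = 1/(2k)`, so dividing by the gap costs `4k` and
  -- turns the 8 per query into `32k`.
  set ρ : ℝ := 1 - 1 / (2 * k) with hρ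
  have hinv : 1 / (2 * k : ℝ) ≤ 1 / 2 := by
    rw [div_le_div_iff₀ (by positivity) (by norm_num)]
    linarith
  have hinv0 : 0 < 1 / (2 * k : ℝ) := by positivity
  have h0 : 0 ≤ ρ := by linarith
  have h1 : ρ < 1 := by linarith
  obtain ⟨w, hw⟩ := exists_isPoissonNoise (X := Reg n) (q := 4 * k) (h := 2 * k) (by ring) ρ h0 h1
  have hcard : (Fintype.card (Reg n) : ℝ) = 2 ^ n := by simp
  have hN : (0 : ℝ) < 2 ^ n := by positivity
  have hG : (0 : ℝ) < Fintype.card (Reg n → ZMod (4 * k)) := Nat.cast_pos.2 Fintype.card_pos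
  set Φ : (Reg n → ZMod (4 * k)) → WorkVec n ℓ m := fun θ => runState V k (phaseVec θ) T with hΦ
  have hnorm := sum_ampSq_outAmp Φ
    (fun θ => sum_normSq_runState_phaseVec V k hkl.le θ T)
  have hoff := offSector_weight_le (ρ := ρ) hw rfl h0 h1.le hkl.le V T
  rw [← hΦ] at hoff
  set η := ∑ r, ampSq (offSector k (outAmp Φ r)) with hη
  have hη0 : 0 ≤ η := Finset.sum_nonneg fun r _ => ampSq_nonneg _
  set Q := ((Fintype.card (Reg n) : ℝ) ^ 2)⁻¹ * ∑ r, ∑ i, ampSq (lower (outAmp Φ r) i) with hQ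
  have hkQ : k + δ ≤ Q := by
    have h2 : (Fintype.card (Reg n → ZMod (4 * k)) : ℝ) * (k + δ) ≤
        Fintype.card (Reg n → ZMod (4 * k)) * Q := by
      rw [hQ, ← sum_fidelity_eq]
      have h3 := Finset.sum_le_sum (s := Finset.univ) fun (θ : Reg n → ZMod (4 * k)) _ =>
        H (phaseVec θ) (norm_phaseVec θ)
      rw [Finset.sum_const, Finset.card_univ, nsmul_eq_mul] at h3
      exact h3
    exact le_of_mul_le_mul_left h2 hG
  have hN2 : (0 : ℝ) < (Fintype.card (Reg n) : ℝ) ^ 2 := by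
    rw [hcard]
    positivity
  constructor
  · refine hkQ.trans ?_
    rw [hQ, inv_mul_le_iff₀ hN2]
    calc _ ≤ ∑ r, ∑ _i : Fin ℓ, (Fintype.card (Reg n) : ℝ) ^ 2 * ampSq (outAmp Φ r) :=
          Finset.sum_le_sum fun r _ => Finset.sum_le_sum fun i _ => ampSq_lower_le _ i
      _ = _ := by
        simp only [Finset.sum_const, Finset.card_univ, Fintype.card_fin, nsmul_eq_mul,
          ← Finset.mul_sum, hnorm]
        ring
  · intro t ht
    have hQle : Q ≤ (k + (k + 1) * ℓ / 2 ^ n + t * ℓ) + (1 + 1 / t) * ℓ * η := by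
      rw [hQ, inv_mul_le_iff₀ hN2]
      calc _ ≤ ∑ r, (Fintype.card (Reg n) : ℝ) ^ 2 *
          ((k + (k + 1) * Fintype.card (Fin ℓ) / Fintype.card (Reg n) +
            t * Fintype.card (Fin ℓ)) * ampSq (outAmp Φ r) +
            (1 + 1 / t) * Fintype.card (Fin ℓ) * ampSq (offSector k (outAmp Φ r))) :=
            Finset.sum_le_sum fun r _ =>
              sum_ampSq_lower_le_of_offSector (by omega) (outAmp Φ r) ht
        _ = _ := by
          rw [← Finset.mul_sum, Finset.sum_add_distrib, ← Finset.mul_sum, ← Finset.mul_sum, hnorm,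
            ← hη, Fintype.card_fin, hcard]
          ring
    have hηle : η ≤ 32 * k * T / √((2 : ℝ) ^ n) := by
      have h2 : 1 / 2 ≤ ρ ^ k := by
        have h3 := one_add_mul_le_pow (a := -(1 / (2 * k : ℝ))) (by linarith) k
        have h4 : 1 + (k : ℝ) * -(1 / (2 * k : ℝ)) = 1 / 2 := by
          field_simp
          ring
        rw [h4] at h3
        exact h3
      have h5 : 1 - ρ = 1 / (2 * k) := by rw [hρ]; ring
      rw [h5, hcard] at hoff
      have hsq : 0 < √((2 : ℝ) ^ n) := Real.sqrt_pos.2 hN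
      have h6 : 1 / 2 * (1 / (2 * k)) * η ≤ T * (8 / √((2 : ℝ) ^ n)) :=
        le_trans (by gcongr) hoff
      calc η = 4 * k * (1 / 2 * (1 / (2 * k)) * η) := by
            field_simp
            ring
        _ ≤ 4 * k * (T * (8 / √((2 : ℝ) ^ n))) := by gcongr
        _ = _ := by ring
    have h7 : (1 + 1 / t) * ℓ * η ≤ (1 + 1 / t) * ℓ * (32 * k * T / √((2 : ℝ) ^ n)) := by
      gcongr
    linarith

end lowerBound

/-! ### Choice of the parameter and final arithmetic -/

theorem query_bound_of_excess {k l T δ s L : ℝ} (hk : 1 ≤ k) (hkl : k + 1 ≤ l) (hδ : 0 < δ)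
    (hs : 0 < s) (hL : 1 / 2 ≤ L) (hT : 0 ≤ T) (hkδ : k + δ ≤ l)
    (H : ∀ t : ℝ, 0 < t → δ ≤ (k + 1) * l / s ^ 2 + t * l + (1 + 1 / t) * l * (32 * k * T / s)) :
    1 / 1280 * (δ ^ 2 * s / (l ^ 2 * k * L) - l) ≤ T := by
  have hk0 : 0 < k := by linarith
  have hl0 : 0 < l := by linarith
  have hL0 : 0 < L := by linarith
  by_cases hc : (k + 1) * l / s ^ 2 ≤ δ / 2
  -- The wrap-around error takes at most `δ/2` and this `t` makes `t * l = δ/4`, which leaves `δ/4`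
  -- to be paid by the queries.
  · have h1 := H (δ / (4 * l)) (by positivity)
    have h2 : δ / (4 * l) * l = δ / 4 := by
      field_simp
    have h3 : (1 + 1 / (δ / (4 * l))) * l * (32 * k * T / s) ≤
        (5 * l / δ) * l * (32 * k * T / s) := by
      have : 1 + 1 / (δ / (4 * l)) ≤ 5 * l / δ := by
        have h4 : 1 / (δ / (4 * l)) = 4 * l / δ := by field_simp
        have h5 : 1 ≤ l / δ := by
          rw [one_le_div hδ]
          linarith
        have h6 : 5 * l / δ = l / δ + 4 * l / δ := by ring
        linarith
      gcongr
    have h4 : δ / 4 ≤ (5 * l / δ) * l * (32 * k * T / s) := by linarith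
    have h5 : δ ^ 2 * s ≤ 640 * l ^ 2 * k * T := by
      have h6 : (5 * l / δ) * l * (32 * k * T / s) = 160 * l ^ 2 * k * T / (δ * s) := by
        field_simp
        ring
      rw [h6, le_div_iff₀ (by positivity)] at h4
      nlinarith
    have h6 : δ ^ 2 * s / (l ^ 2 * k * L) ≤ 1280 * T := by
      rw [div_le_iff₀ (by positivity)]
      have h7 : 0 ≤ l ^ 2 * k * T := by positivity
      nlinarith
    linarith
  · push Not at hc
    -- Here `s²` is below `2(k+1)l/δ`, so small that the main term does not exceed `l` and the
    -- claimed bound is nonpositive. The estimate uses `δ ≤ l - 1` and `4(l - 1) ≤ l²`.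
    have hD : δ ^ 2 * s / (l ^ 2 * k * L) ≤ l := by
      by_contra hD
      push Not at hD
      rw [lt_div_iff₀ (by positivity)] at hD
      rw [lt_div_iff₀ (by positivity)] at hc
      have h1 : (l * (l ^ 2 * k * L)) ^ 2 < (δ ^ 2 * s) ^ 2 := by
        gcongr
      have h2 : (δ ^ 2 * s) ^ 2 ≤ 4 * k ^ 2 * l * δ ^ 3 := by
        have h3 : δ ^ 3 * (δ * s ^ 2) ≤ δ ^ 3 * (2 * ((k + 1) * l)) :=
          mul_le_mul_of_nonneg_left (by linarith) (by positivity)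
        have h4 : k + 1 ≤ 2 * k ^ 2 := by nlinarith
        have h5 : δ ^ 3 * (2 * ((k + 1) * l)) ≤ δ ^ 3 * (2 * ((2 * k ^ 2) * l)) := by gcongr
        nlinarith
      have h3 : δ ^ 3 ≤ (l - 1) ^ 3 := by
        gcongr
        linarith
      have h4 : 16 * (l - 1) ^ 3 ≤ l ^ 5 := by
        have h5 : 4 * (l - 1) ≤ l ^ 2 := by nlinarith [sq_nonneg (l - 2)]
        have h6 : (4 * (l - 1)) ^ 2 ≤ (l ^ 2) ^ 2 := by
          have : 0 ≤ 4 * (l - 1) := by linarith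
          gcongr
        have h7 : (4 * (l - 1)) ^ 2 * (l - 1) ≤ (l ^ 2) ^ 2 * l :=
          mul_le_mul h6 (by linarith) (by linarith) (by positivity)
        nlinarith
      have h5 : 4 * k ^ 2 * l * δ ^ 3 ≤ 4 * k ^ 2 * l * (l ^ 5 / 16) := by
        gcongr
        linarith
      have h6 : 4 * k ^ 2 * l * (l ^ 5 / 16) ≤ (l * (l ^ 2 * k * L)) ^ 2 := by
        have h7 : (1 / 2) ^ 2 ≤ L ^ 2 := by gcongr
        have h8 : (l * (l ^ 2 * k * L)) ^ 2 = k ^ 2 * l ^ 6 * L ^ 2 := by ring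
        rw [h8]
        have h9 : k ^ 2 * l ^ 6 * (1 / 2) ^ 2 ≤ k ^ 2 * l ^ 6 * L ^ 2 := by gcongr
        nlinarith
      linarith
    linarith

theorem theorem2 :
    ∃ c : ℝ, 0 < c ∧
      ∀ (n k ℓ m T : ℕ) (δ : ℝ), 1 ≤ k → k < ℓ → 0 < δ →
        ∀ V : ℕ → Matrix.unitaryGroup (Work n ℓ m) ℂ,
          (∀ ψ : EuclideanSpace ℂ (Reg n), ‖ψ‖ = 1 →
            (k : ℝ) + δ ≤ ∑ i : Fin ℓ, fidelity ψ (reducedState (runState V k ψ T) i)) →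
          c * (δ ^ 2 * Real.sqrt ((2 : ℝ) ^ n) /
              ((ℓ : ℝ) ^ 2 * k * Real.log (max (k : ℝ) 2)) - ℓ) ≤ (T : ℝ) := by
  refine ⟨1 / 1280, by norm_num, fun n k ℓ m T δ hk hkl hδ V H => ?_⟩
  obtain ⟨h1, h2⟩ := excess_bounds hk hkl V H
  have hs : (0 : ℝ) < √((2 : ℝ) ^ n) := Real.sqrt_pos.2 (by positivity)
  -- The argument gives the bound without a logarithm; `log 2 ≥ 1/2` absorbs the weaker denominator
  -- into the constant, `640 · 2 = 1280`.
  have hL : 1 / 2 ≤ Real.log (max (k : ℝ) 2) := by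
    have h3 : Real.log 2 ≤ Real.log (max (k : ℝ) 2) :=
      Real.log_le_log (by norm_num) (le_max_right _ _)
    linarith [Real.log_two_gt_d9]
  refine query_bound_of_excess (by exact_mod_cast hk) (by exact_mod_cast hkl) hδ hs hL
    (Nat.cast_nonneg T) h1 fun t ht => ?_
  rw [Real.sq_sqrt (by positivity)]
  exact h2 t ht
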